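/- Let $(M,\omega)$ be a compact symplectic manifold (without boundary) of dimension $2n$, $n\ge 1$, with Poisson bracket $\{f,g\}=\omega(X_f,X_g)$, where the Hamiltonian field $X_f$ is defined by $\omega(X_f,\cdot)=df$. Let $\mathrm{Dens}$ be the space of smooth volume forms $d\nu$ on $M$, positive for the orientation given by $\omega^n$, with $\int_M d\nu=1$, equipped with the $C^\infty$ topology; its tangent space at every point is the space of smooth $2n$-forms on $M$ with zero integral. For $f\in C^\infty(M)$ put $F_f(d\nu)=\int_M f\,d\nu$ and $$\{F_f,F_g\}_{\mathrm{Dens}}:=F_{\{f,g\}} .$$ A Hamiltonian trajectory in $\mathrm{Dens}$ is a smooth curve $\nu_t$ in $\mathrm{Dens}$ for which there is a smooth family $f_t\in C^\infty(M)$, $t\in\mathbb R$, with $\frac{d}{dt}F_g(\nu_t)=\{F_g,F_{f_t}\}_{\mathrm{Dens}}(\nu_t)$ for all $t$ and all $g\in C^\infty(M)$. Two points of $\mathrm{Dens}$ lie in the same symplectic leaf of $\{\,,\}_{\mathrm{Dens}}$ if they can be joined by a finite chain of Hamiltonian trajectories. A Casimir is a functional $\mathrm{Dens}\to\mathbb R$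 that is constant on every symplectic leaf. 1. For every function $h:\mathbb R\to\mathbb R$ the functional $$C_h(d\nu)=\int_M h\Big(\frac{d\nu}{\omega^n}\Big)\,\omega^n$$ is a Casimir. More precisely, if $d\nu$ and $d\nu'$ lie in the same symplectic leaf, then the integral defining $C_h(d\nu)$ converges absolutely if and only if the one defining $C_h(d\nu')$ does, and $C_h(d\nu)=C_h(d\nu')$ (an integral that does not converge absolutely, or whose integrand is not measurable, being given the value $0$). 2. The bracket $\{\,,\}_{\mathrm{Dens}}$ admits infinitely many functionally independent Casimirs of this form: there is a sequence of smooth functions $h_k:\mathbb R\to\mathbb R$, $k\in\mathbb N$, such that all $C_{h_k}$ are Casimirs and, at every point of a dense open subset of $\mathrm{Dens}$, the differentials of the functionals $C_{h_k}$, $k\in\mathbb N$, exist and are linearly independent linear forms on the tangent space of $\mathrm{Dens}$. (A linear form $L$ on the tangent space at $d\nu$ is the differential of $C$ there if $\frac{d}{ds}\big|_{s=0}C(\gamma_s)=L(\dot\gamma_0)$ for every smooth curve $\gamma$ in $\mathrm{Dens}$ with $\gamma_0=d\nu$.) -/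

import Mathlib

open Set MeasureTheory Topology
open scoped Manifold ContDiff

noncomputable section

/-! ### Differential forms on a manifold without boundary -/

/-- The model space of a manifold of dimension `d`. -/
abbrev Eucl (d : ℕ) : Type := EuclideanSpace ℝ (Fin d)

/-- A (not necessarily smooth) differential `k`-form on the `d`-dimensional manifold `M`. -/
abbrev DiffForm (d : ℕ) (M : Type*) [TopologicalSpace M] [ChartedSpace (Eucl d) M] (k : ℕ) :
    Type _ :=
  ∀ x : M, (TangentSpace (𝓡 d) x) [⋀^Fin k]→L[ℝ] ℝ

namespace DiffForm

variable {d : ℕ} {M : Type*} [TopologicalSpace M] [ChartedSpace (Eucl d) M] {k : ℕ}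

/-- The form `α` written in the chart around `x₀`, that is, its pull-back under the inverse of this
chart. It is meaningful on the (open) target of the chart. -/
def inChart (α : DiffForm d M k) (x₀ : M) (y : Eucl d) : (Eucl d) [⋀^Fin k]→L[ℝ] ℝ :=
  (α ((extChartAt (𝓡 d) x₀).symm y)).compContinuousLinearMap
    (mfderiv (𝓡 d) (𝓡 d) (extChartAt (𝓡 d) x₀).symm y)

/-- A form is smooth if it is smooth in the charts. -/
def IsSmooth (α : DiffForm d M k) : Prop :=
  ∀ x₀ : M, ContDiffOn ℝ ∞ (α.inChart x₀) (extChartAt (𝓡 d) x₀).target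

/-- A form is closed if its exterior derivative vanishes in the charts. -/
def IsClosedForm (α : DiffForm d M k) : Prop :=
  ∀ x₀ : M, ∀ y ∈ (extChartAt (𝓡 d) x₀).target, extDeriv (α.inChart x₀) y = 0

theorem inChart_add (α β : DiffForm d M k) (x₀ : M) :
    (α + β).inChart x₀ = α.inChart x₀ + β.inChart x₀ := rfl

theorem inChart_smul (c : ℝ) (α : DiffForm d M k) (x₀ : M) :
    (c • α).inChart x₀ = c • α.inChart x₀ := rfl

theorem IsSmooth.add {α β : DiffForm d M k} (hα : α.IsSmooth) (hβ : β.IsSmooth) :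
    (α + β).IsSmooth := fun x₀ => by
  rw [inChart_add]; exact (hα x₀).add (hβ x₀)

theorem IsSmooth.smul {α : DiffForm d M k} (c : ℝ) (hα : α.IsSmooth) : (c • α).IsSmooth :=
  fun x₀ => by
    rw [inChart_smul]; exact contDiffOn_const.smul (hα x₀)

theorem isSmooth_zero : (0 : DiffForm d M k).IsSmooth := fun x₀ => by
  have h : (0 : DiffForm d M k).inChart x₀ = fun _ => 0 := rfl
  rw [h]; exact contDiffOn_const

/-- The value of a top-degree form at `x` on the standard basis of the tangent space. -/
def coeff (α : DiffForm d M d) (x : M) : ℝ :=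
  α x (fun i => (EuclideanSpace.single i (1 : ℝ) : Eucl d))

end DiffForm

/-! ### The `n`-th exterior power of a 2-form -/

section WedgePow

variable {V : Type*} [AddCommGroup V] [Module ℝ V] [TopologicalSpace V]

theorem pair_add_left (w : V [⋀^Fin 2]→L[ℝ] ℝ) (x y z : V) :
    w ![x + y, z] = w ![x, z] + w ![y, z] := by
  have h : ∀ u, Function.update ![x, z] 0 u = ![u, z] := fun u => by
    funext i; fin_cases i <;> simp
  have key := w.toAlternatingMap.map_update_add ![x, z] 0 x y
  simp only [h] at key
  exact key

theorem pair_add_right (w : V [⋀^Fin 2]→L[ℝ] ℝ) (z x y : V) :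
    w ![z, x + y] = w ![z, x] + w ![z, y] := by
  have h : ∀ u, Function.update ![z, x] 1 u = ![z, u] := fun u => by
    funext i; fin_cases i <;> simp
  have key := w.toAlternatingMap.map_update_add ![z, x] 1 x y
  simp only [h] at key
  exact key

theorem pair_smul_left (w : V [⋀^Fin 2]→L[ℝ] ℝ) (c : ℝ) (x z : V) :
    w ![c • x, z] = c * w ![x, z] := by
  have h : ∀ u, Function.update ![x, z] 0 u = ![u, z] := fun u => by
    funext i; fin_cases i <;> simp
  have key := w.toAlternatingMap.map_update_smul ![x, z] 0 c x
  simp only [h] at key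
  exact key

theorem pair_smul_right (w : V [⋀^Fin 2]→L[ℝ] ℝ) (c : ℝ) (z x : V) :
    w ![z, c • x] = c * w ![z, x] := by
  have h : ∀ u, Function.update ![z, x] 1 u = ![z, u] := fun u => by
    funext i; fin_cases i <;> simp
  have key := w.toAlternatingMap.map_update_smul ![z, x] 1 c x
  simp only [h] at key
  exact key

/-- As a function of one of its arguments, the product over the pairs is linear. -/
theorem exists_linear_prod_update (w : V [⋀^Fin 2]→L[ℝ] ℝ) (n : ℕ) (v : Fin (2 * n) → V)
    (k : Fin (2 * n)) :
    ∃ A : V →ₗ[ℝ] ℝ, ∀ x, ∏ i : Fin n, w ![Function.update v k x ⟨2 * i, by omega⟩,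
      Function.update v k x ⟨2 * i + 1, by omega⟩] = A x := by
  classical
  let i₀ : Fin n := ⟨k / 2, by omega⟩
  have hrest : ∀ x, ∏ i ∈ Finset.univ.erase i₀, w ![Function.update v k x ⟨2 * i, by omega⟩,
      Function.update v k x ⟨2 * i + 1, by omega⟩] =
      ∏ i ∈ Finset.univ.erase i₀, w ![v ⟨2 * i, by omega⟩, v ⟨2 * i + 1, by omega⟩] := by
    intro x
    refine Finset.prod_congr rfl fun i hi => ?_
    have hne : (i : ℕ) ≠ k / 2 := fun h => (Finset.ne_of_mem_erase hi) (Fin.ext h)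
    rw [Function.update_of_ne (Fin.ne_of_val_ne (by dsimp; omega)),
      Function.update_of_ne (Fin.ne_of_val_ne (by dsimp; omega))]
  rcases Nat.even_or_odd' (k : ℕ) with ⟨m, hm | hm⟩
  · have h1 : (⟨2 * i₀, by omega⟩ : Fin (2 * n)) = k := Fin.ext (by simp [i₀]; omega)
    have h2 : (⟨2 * i₀ + 1, by omega⟩ : Fin (2 * n)) ≠ k := Fin.ne_of_val_ne (by simp [i₀]; omega)
    refine ⟨{
      toFun := fun x => w ![x, v ⟨2 * i₀ + 1, by omega⟩] * ∏ i ∈ Finset.univ.erase i₀,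
        w ![v ⟨2 * i, by omega⟩, v ⟨2 * i + 1, by omega⟩]
      map_add' := fun x y => by rw [pair_add_left, add_mul]
      map_smul' := fun c x => by rw [pair_smul_left]; simp [mul_assoc] }, fun x => ?_⟩
    rw [← Finset.mul_prod_erase _ _ (Finset.mem_univ i₀), hrest, h1, Function.update_self, Function.update_of_ne h2]
    rfl
  · have h1 : (⟨2 * i₀ + 1, by omega⟩ : Fin (2 * n)) = k := Fin.ext (by simp [i₀]; omega)
    have h2 : (⟨2 * i₀, by omega⟩ : Fin (2 * n)) ≠ k := Fin.ne_of_val_ne (by simp [i₀]; omega)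
    refine ⟨{
      toFun := fun x => w ![v ⟨2 * i₀, by omega⟩, x] * ∏ i ∈ Finset.univ.erase i₀,
        w ![v ⟨2 * i, by omega⟩, v ⟨2 * i + 1, by omega⟩]
      map_add' := fun x y => by rw [pair_add_right, add_mul]
      map_smul' := fun c x => by rw [pair_smul_right]; simp [mul_assoc] }, fun x => ?_⟩
    rw [← Finset.mul_prod_erase _ _ (Finset.mem_univ i₀), hrest, h1, Function.update_self, Function.update_of_ne h2]
    rfl

/-- The multilinear map `(v₀, …, v₂ₙ₋₁) ↦ ∏ i, w (v₂ᵢ, v₂ᵢ₊₁)`, i.e. `w ⊗ ⋯ ⊗ w`. -/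
def tensorPow (w : V [⋀^Fin 2]→L[ℝ] ℝ) (n : ℕ) :
    ContinuousMultilinearMap ℝ (fun _ : Fin (2 * n) => V) ℝ where
  toFun v := ∏ i : Fin n, w ![v ⟨2 * i, by omega⟩, v ⟨2 * i + 1, by omega⟩]
  map_update_add' v k x y := by
    obtain ⟨A, hA⟩ := exists_linear_prod_update w n v k
    convert A.map_add x y using 2
    all_goals rw [← hA]; congr!
  map_update_smul' v k c x := by
    obtain ⟨A, hA⟩ := exists_linear_prod_update w n v k
    convert A.map_smul c x using 2
    all_goals rw [← hA]; congr!
  cont := by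
    refine continuous_finsetProd _ fun i _ => w.cont.comp ?_
    refine continuous_pi fun j => ?_
    fin_cases j
    · exact continuous_apply _
    · exact continuous_apply _

/-- The exterior power `wⁿ = w ∧ ⋯ ∧ w` of an alternating 2-form. In the usual normalization
`(a ∧ b) = (1 / (k! l!)) ∑ σ, sgn σ • (a ⊗ b) ∘ σ` it is
`wⁿ (v₀, …, v₂ₙ₋₁) = 2⁻ⁿ ∑ σ, sgn σ ∏ i, w (v_{σ (2i)}, v_{σ (2i+1)})`. -/
def wedgePow (w : V [⋀^Fin 2]→L[ℝ] ℝ) (n : ℕ) : V [⋀^Fin (2 * n)]→L[ℝ] ℝ :=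
  ((2 : ℝ) ^ n)⁻¹ • ContinuousMultilinearMap.alternatization (tensorPow w n)

end WedgePow

/-! ### Symplectic manifolds -/

/-- A symplectic form on the `2n`-dimensional manifold `M`. -/
structure SymplecticForm (n : ℕ) (M : Type*) [TopologicalSpace M]
    [ChartedSpace (Eucl (2 * n)) M] where
  /-- the underlying 2-form -/
  form : DiffForm (2 * n) M 2
  smooth : form.IsSmooth
  closed : form.IsClosedForm
  nondegenerate : ∀ (x : M) (v : TangentSpace (𝓡 (2 * n)) x),
    (∀ w : TangentSpace (𝓡 (2 * n)) x, form x ![v, w] = 0) → v = 0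

namespace SymplecticForm

variable {n : ℕ} {M : Type*} [TopologicalSpace M] [ChartedSpace (Eucl (2 * n)) M]
  (Ω : SymplecticForm n M)

/-- The linear map `v ↦ ω(v, ·)`. -/
def flat (x : M) :
    TangentSpace (𝓡 (2 * n)) x →ₗ[ℝ] Module.Dual ℝ (TangentSpace (𝓡 (2 * n)) x) :=
  LinearMap.mk₂ ℝ (fun v w => Ω.form x ![v, w])
    (fun _ _ _ => pair_add_left _ _ _ _) (fun _ _ _ => pair_smul_left _ _ _ _)
    (fun _ _ _ => pair_add_right _ _ _ _) (fun _ _ _ => pair_smul_right _ _ _ _)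

theorem flat_bijective (x : M) : Function.Bijective (Ω.flat x) := by
  have : FiniteDimensional ℝ (TangentSpace (𝓡 (2 * n)) x) :=
    inferInstanceAs (FiniteDimensional ℝ (Eucl (2 * n)))
  have hinj : Function.Injective (Ω.flat x) :=
    (injective_iff_map_eq_zero _).2 fun v hv =>
      Ω.nondegenerate x v fun w => LinearMap.congr_fun hv w
  exact ⟨hinj, (LinearMap.injective_iff_surjective_of_finrank_eq_finrank
    Subspace.dual_finrank_eq.symm).1 hinj⟩

/-- The isomorphism `v ↦ ω(v, ·)` between tangent and cotangent space. -/
def flatEquiv (x : M) :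
    TangentSpace (𝓡 (2 * n)) x ≃ₗ[ℝ] Module.Dual ℝ (TangentSpace (𝓡 (2 * n)) x) :=
  LinearEquiv.ofBijective (Ω.flat x) (Ω.flat_bijective x)

/-- The Hamiltonian vector field `X_f`, defined by `ω(X_f, ·) = df`. -/
def hamVectorField (f : M → ℝ) (x : M) : TangentSpace (𝓡 (2 * n)) x :=
  (Ω.flatEquiv x).symm (mfderiv (𝓡 (2 * n)) 𝓘(ℝ, ℝ) f x).toLinearMap

/-- The Poisson bracket `{f, g} = ω(X_f, X_g)`. -/
def poissonBracket (f g : M → ℝ) (x : M) : ℝ :=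
  Ω.form x ![Ω.hamVectorField f x, Ω.hamVectorField g x]

/-- The Liouville volume form `ωⁿ`. -/
def liouvilleForm : DiffForm (2 * n) M (2 * n) := fun x => wedgePow (Ω.form x) n

/-- The ratio `α / ωⁿ` of a top-degree form `α` and the Liouville form, a function on `M`. -/
def ratio (α : DiffForm (2 * n) M (2 * n)) (x : M) : ℝ :=
  α.coeff x / Ω.liouvilleForm.coeff x

theorem ratio_zero : Ω.ratio 0 = fun _ => 0 := by
  funext x; exact zero_div _

theorem ratio_add (α β : DiffForm (2 * n) M (2 * n)) :
    Ω.ratio (α + β) = Ω.ratio α + Ω.ratio β := by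
  funext x; exact add_div _ _ _

theorem ratio_smul (c : ℝ) (α : DiffForm (2 * n) M (2 * n)) :
    Ω.ratio (c • α) = c • Ω.ratio α := by
  funext x; exact mul_div_assoc _ _ _

/-- The measure on `M` defined by the volume form `ωⁿ`. On the domain of every chart it is Lebesgue
measure with density `|ωⁿ(∂₁, …, ∂₂ₙ)|`; it is the supremum (in the lattice of measures) of these
local measures, extended by zero, which agree on the overlaps of the charts. -/
def liouvilleMeasure [MeasurableSpace M] : Measure M :=
  ⨆ x₀ : M, Measure.map (extChartAt (𝓡 (2 * n)) x₀).symm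
    ((volume.restrict (extChartAt (𝓡 (2 * n)) x₀).target).withDensity fun y =>
      ENNReal.ofReal |Ω.liouvilleForm.inChart x₀ y fun i => EuclideanSpace.single i (1 : ℝ)|)

variable [MeasurableSpace M]

/-- The top-degree form `α` is absolutely integrable over `M`. -/
def FormIntegrable (α : DiffForm (2 * n) M (2 * n)) : Prop :=
  Integrable (Ω.ratio α) Ω.liouvilleMeasure

/-- The integral `∫_M α` of a top-degree form, where `M` is oriented by `ωⁿ`. -/
def integral (α : DiffForm (2 * n) M (2 * n)) : ℝ :=
  ∫ x, Ω.ratio α x ∂Ω.liouvilleMeasure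

/-! ### The space of smooth densities -/

/-- `Dens`: the smooth volume forms (positive for the orientation given by `ωⁿ`) of total
integral 1. -/
def Dens : Type _ :=
  {ν : DiffForm (2 * n) M (2 * n) //
    ν.IsSmooth ∧ (∀ x, 0 < Ω.ratio ν x) ∧ Ω.integral ν = 1}

variable {Ω} in
/-- The volume form underlying an element of `Dens`. -/
def Dens.form (ν : Ω.Dens) : DiffForm (2 * n) M (2 * n) := ν.1

/-- The `C^∞` topology on `Dens`: uniform convergence of all derivatives, in every chart, on the
compact subsets of the chart. -/
instance : TopologicalSpace Ω.Dens :=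
  ⨅ (x₀ : M) (j : ℕ), TopologicalSpace.induced
    (fun ν : Ω.Dens => UniformOnFun.ofFun
      {K : Set (Eucl (2 * n)) | IsCompact K ∧ K ⊆ (extChartAt (𝓡 (2 * n)) x₀).target}
      (iteratedFDeriv ℝ j (ν.form.inChart x₀)))
    inferInstance

/-- The tangent space to `Dens` (at any of its points): the smooth top-degree forms of integral
zero. (On a compact manifold integrability is automatic.) -/
def tangentDens : Submodule ℝ (DiffForm (2 * n) M (2 * n)) where
  carrier := {β | β.IsSmooth ∧ Ω.FormIntegrable β ∧ Ω.integral β = 0}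
  zero_mem' := by
    have h : Ω.ratio 0 = fun _ => 0 := Ω.ratio_zero
    refine ⟨DiffForm.isSmooth_zero, ?_, ?_⟩
    · rw [FormIntegrable, h]; exact integrable_zero _ _ _
    · rw [integral, h]; simp
  add_mem' := by
    rintro α β ⟨h1, h2, h3⟩ ⟨k1, k2, k3⟩
    have h : Ω.ratio (α + β) = Ω.ratio α + Ω.ratio β := Ω.ratio_add α β
    refine ⟨h1.add k1, ?_, ?_⟩
    · rw [FormIntegrable, h]; exact h2.add k2
    · rw [integral, h, integral_add' h2 k2, ← integral, ← integral, h3, k3, add_zero]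
  smul_mem' := by
    rintro c α ⟨h1, h2, h3⟩
    have h : Ω.ratio (c • α) = c • Ω.ratio α := Ω.ratio_smul c α
    refine ⟨h1.smul c, ?_, ?_⟩
    · rw [FormIntegrable, h]; exact h2.smul c
    · rw [integral, h]
      simp only [Pi.smul_apply]
      rw [integral_smul, ← integral, h3, smul_zero]

variable {Ω} in
/-- A smooth curve `t ↦ γ t` in `Dens`: the forms `γ t` depend smoothly on `t` and on the point of
`M` jointly. -/
def IsSmoothCurve (γ : ℝ → Ω.Dens) : Prop :=
  ∀ x₀ : M, ContDiffOn ℝ ∞ (fun p : ℝ × Eucl (2 * n) => (γ p.1).form.inChart x₀ p.2)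
    (univ ×ˢ (extChartAt (𝓡 (2 * n)) x₀).target)

variable {Ω} in
/-- The form `β` is the velocity at time `t` of the curve `γ` in `Dens`. -/
def HasVelocityAt (γ : ℝ → Ω.Dens) (β : DiffForm (2 * n) M (2 * n)) (t : ℝ) : Prop :=
  ∀ (x : M) (v : Fin (2 * n) → TangentSpace (𝓡 (2 * n)) x),
    HasDerivAt (fun s => (γ s).form x v) (β x v) t

variable {Ω} in
/-- The linear form `L` on the tangent space is the differential at `ν` of the functional `C` on
`Dens`: along every smooth curve through `ν` the chain rule holds. -/
def HasDifferentialAt (C : Ω.Dens → ℝ) (L : Module.Dual ℝ Ω.tangentDens) (ν : Ω.Dens) : Prop :=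
  ∀ (γ : ℝ → Ω.Dens) (β : Ω.tangentDens), IsSmoothCurve γ → γ 0 = ν → HasVelocityAt γ β 0 →
    HasDerivAt (fun s => C (γ s)) (L β) 0

variable {Ω} in
/-- Functional independence of a family of functionals on `Dens`: their differentials exist and are
linearly independent at all points of a dense open set. -/
def FunctionallyIndependent {ι : Type*} (C : ι → Ω.Dens → ℝ) : Prop :=
  ∃ U : Set Ω.Dens, IsOpen U ∧ Dense U ∧ ∀ ν ∈ U, ∃ L : ι → Module.Dual ℝ Ω.tangentDens,
    (∀ i, HasDifferentialAt (C i) (L i) ν) ∧ LinearIndependent ℝ L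

/-! ### The Poisson bracket on `Dens`, its symplectic leaves and Casimirs -/

/-- The linear functional `F_f(dν) = ∫_M f dν` on `Dens`. -/
def linFunctional (f : M → ℝ) (ν : Ω.Dens) : ℝ :=
  Ω.integral fun x => f x • ν.form x

/-- The bracket `{·,·}_Dens` of the linear functionals `F_f` and `F_g` on `Dens`: it is defined by
`{F_f, F_g}_Dens = F_{{f, g}}`. -/
def densBracket (f g : M → ℝ) : Ω.Dens → ℝ :=
  Ω.linFunctional (Ω.poissonBracket f g)

variable {Ω} in
/-- The smooth curve `γ` in `Dens` is a trajectory of the Hamiltonian vector field, for the bracket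
`{·,·}_Dens`, of the time-dependent Hamiltonian `F_{f_t}`: one has `(d/dt) F_g = {F_g, F_{f_t}}_Dens`
along `γ`, for every linear functional `F_g`. -/
def IsHamiltonianTrajectory (f : ℝ → M → ℝ) (γ : ℝ → Ω.Dens) : Prop :=
  ∀ (t : ℝ) (g : M → ℝ), ContMDiff (𝓡 (2 * n)) 𝓘(ℝ, ℝ) ∞ g →
    HasDerivAt (fun s => Ω.linFunctional g (γ s)) (Ω.densBracket g (f t) (γ t)) t

variable {Ω} in
/-- `ν'` is reached from `ν` along one trajectory of a smooth time-dependent Hamiltonian vector field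
on `Dens`. -/
def HamiltonianJoined (ν ν' : Ω.Dens) : Prop :=
  ∃ (f : ℝ → M → ℝ) (γ : ℝ → Ω.Dens),
    ContMDiff (𝓘(ℝ, ℝ).prod (𝓡 (2 * n))) 𝓘(ℝ, ℝ) ∞ (fun p : ℝ × M => f p.1 p.2) ∧
    IsSmoothCurve γ ∧ IsHamiltonianTrajectory f γ ∧ γ 0 = ν ∧ γ 1 = ν'

variable {Ω} in
/-- The symplectic leaf through `ν` of the Poisson structure on `Dens`: all points that can be joined
to `ν` by a chain of finitely many trajectories of (time-dependent) Hamiltonian vector fields. -/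
def symplecticLeaf (ν : Ω.Dens) : Set Ω.Dens :=
  {ν' | Relation.EqvGen HamiltonianJoined ν ν'}

variable {Ω} in
/-- A Casimir: a functional on `Dens` that is constant on the symplectic leaves. -/
def IsCasimir (C : Ω.Dens → ℝ) : Prop :=
  ∀ ν : Ω.Dens, ∀ ν' ∈ symplecticLeaf ν, C ν' = C ν

/-- The form `h(dν / ωⁿ) ωⁿ`. -/
def casimirForm (h : ℝ → ℝ) (ν : Ω.Dens) : DiffForm (2 * n) M (2 * n) :=
  fun x => h (Ω.ratio ν.form x) • Ω.liouvilleForm x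

/-- The functional `C_h(dν) = ∫_M h(dν / ωⁿ) ωⁿ`. -/
def casimir (h : ℝ → ℝ) (ν : Ω.Dens) : ℝ :=
  Ω.integral (Ω.casimirForm h ν)

end SymplecticForm

end

/-!
Write `ρ = ν / ωⁿ` for the function that represents a density `ν`, and `μ` for the Liouville
measure.

**Casimirs.** Along a Hamiltonian trajectory `ρ_t` obeys a Liouville equation, so that `ρ_t` is
carried along by volume-preserving maps. No flow is constructed here: it is enough to know that
the law of `ρ_t` under `μ` does not change. For smooth `φ`, testing the equation of motion with
`g = φ'(ρ_t)` gives `d/dt ∫ φ(ρ_t) dμ = ∫ {φ'(ρ_t), f_t} ρ_t dμ = ∫ {Ψ(ρ_t), f_t} dμ` with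
`Ψ(s) = s φ'(s) - φ(s)`, and Poisson brackets have integral zero
(`SymplecticForm.integral_poissonBracket_eq_zero`). With `φ = cos(t ·), sin(t ·)` the
characteristic function of the law is conserved (`SymplecticForm.law_eq_of_mem_symplecticLeaf`).
For an arbitrary function `h`, the integral `∫ h(ρ) dμ` depends on the law only, and so does its
existence: `μ` is inner regular for compact sets, and thus a set of reals is measurable for the
law as soon as its preimage under the continuous function `ρ` is measurable
(`nullMeasurableSet_map_of_preimage`).

**Liouville's theorem.** A partition of unity reduces `∫ {u, f} dμ = 0` to an `f` supported in a
chart. There `X_f` satisfies `L_X ω = 0` because `ω` is closed (`lie_localHam`), hence the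
coefficient `W` of `ωⁿ` satisfies `dW(X) + W div X = 0`. The latter is obtained by differentiating
the identity `(A^* ω)ⁿ = det A · ωⁿ` at `A = 1` (`fderiv_wedgePow_lie`). So `{u, f} |W|` is the
divergence of the compactly supported field `u |W| X_f`.

**Independence.** Take `h_k(s) = s ^ (k + 2)`. The differential of `C_φ` at `ν` is
`β ↦ ∫ φ'(ρ) β`. If a linear combination of the differentials vanishes, with `P = ∑ c_k h_k'`, then testing it
with `β = (P(ρ) - m) ν`, where `m` is the `ν`-mean of `P(ρ)`, shows that `P(ρ) = m` everywhere. If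
`ρ` takes infinitely many values then `P` is constant, and all `c_k` vanish. By connectedness, `ρ`
takes infinitely many values if it is not constant on a fixed ball in a chart; this condition is
open, and it is dense because every `ν` is a limit of normalized densities `(1 + s ψ) ν` with a
bump function `ψ`.
-/

noncomputable section

/-! ### Top-degree forms and exterior powers of 2-forms -/

/-- The standard basis of the model space. -/
abbrev stdFrame (d : ℕ) : Fin d → Eucl d := fun i => EuclideanSpace.single i (1 : ℝ)

theorem map_stdFrame_eq_det {d : ℕ} (α : (Eucl d) [⋀^Fin d]→L[ℝ] ℝ) (A : Eucl d →L[ℝ] Eucl d) :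
    α (fun i => A (stdFrame d i)) = LinearMap.det (A : Eucl d →ₗ[ℝ] Eucl d) * α (stdFrame d) := by
  let b := (EuclideanSpace.basisFun (Fin d) ℝ).toBasis
  have hb : ⇑b = stdFrame d := by ext i; simp [b]
  have h := α.toAlternatingMap.eq_smul_basis_det b
  have h1 : ∀ v, α v = α (stdFrame d) * b.det v := fun v => by
    have := congrArg (fun f => f v) h
    simpa [hb] using this
  rw [h1]
  have h2 := b.det_comp (A : Eucl d →ₗ[ℝ] Eucl d) b
  rw [b.det_self, hb] at h2
  have h3 : b.det (fun i => A (stdFrame d i)) = LinearMap.det (A : Eucl d →ₗ[ℝ] Eucl d) := by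
    simpa [Function.comp_def] using h2
  rw [h3]; ring

section WedgePow

theorem wedgePow_apply {V : Type*} [AddCommGroup V] [Module ℝ V] [TopologicalSpace V]
    (w : V [⋀^Fin 2]→L[ℝ] ℝ) (n : ℕ) (v : Fin (2 * n) → V) :
    wedgePow w n v = ((2 : ℝ) ^ n)⁻¹ * ∑ σ : Equiv.Perm (Fin (2 * n)), (Equiv.Perm.sign σ : ℝ) *
      ∏ i : Fin n, w ![v (σ ⟨2 * i, by omega⟩), v (σ ⟨2 * i + 1, by omega⟩)] := by
  simp only [wedgePow, ContinuousAlternatingMap.smul_apply, smul_eq_mul]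
  rw [ContinuousMultilinearMap.alternatization_apply_apply]
  congr 1
  refine Finset.sum_congr rfl fun σ _ => ?_
  rw [Units.smul_def, zsmul_eq_mul]
  rfl

theorem wedgePow_compContinuousLinearMap {V V' : Type*} [AddCommGroup V] [Module ℝ V]
    [TopologicalSpace V] [AddCommGroup V'] [Module ℝ V'] [TopologicalSpace V']
    (w : V [⋀^Fin 2]→L[ℝ] ℝ) (A : V' →L[ℝ] V) (n : ℕ) :
    wedgePow (w.compContinuousLinearMap A) n = (wedgePow w n).compContinuousLinearMap A := by
  ext v
  rw [ContinuousAlternatingMap.compContinuousLinearMap_apply, wedgePow_apply, wedgePow_apply]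
  have (x y : V') : A ∘ ![x, y] = ![A x, A y] := by ext i; fin_cases i <;> rfl
  simp [this]

variable {V : Type*} [NormedAddCommGroup V] [NormedSpace ℝ V]

theorem contDiff_eval_alternating {k : ℕ} (v : Fin k → V) :
    ContDiff ℝ ∞ fun w : V [⋀^Fin k]→L[ℝ] ℝ => w v :=
  (ContinuousAlternatingMap.apply ℝ V ℝ v).contDiff

theorem contDiff_wedgePow_apply (n : ℕ) (v : Fin (2 * n) → V) :
    ContDiff ℝ ∞ fun w : V [⋀^Fin 2]→L[ℝ] ℝ => wedgePow w n v := by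
  simp only [wedgePow_apply]
  refine contDiff_const.mul (ContDiff.sum fun σ _ => contDiff_const.mul ?_)
  exact contDiff_prod fun i _ => contDiff_eval_alternating _

end WedgePow

theorem hasDerivAt_det_one_add_smul {d : ℕ} (Q : Eucl d →L[ℝ] Eucl d) :
    HasDerivAt (fun s : ℝ =>
        LinearMap.det ((1 + s • Q : Eucl d →L[ℝ] Eucl d) : Eucl d →ₗ[ℝ] Eucl d))
      (LinearMap.trace ℝ _ (Q : Eucl d →ₗ[ℝ] Eucl d)) 0 := by
  let b := (EuclideanSpace.basisFun (Fin d) ℝ).toBasis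
  let N := LinearMap.toMatrix b b (Q : Eucl d →ₗ[ℝ] Eucl d)
  have h : ∀ s : ℝ, LinearMap.det ((1 + s • Q : Eucl d →L[ℝ] Eucl d) : Eucl d →ₗ[ℝ] Eucl d) =
      1 + N.trace * s +
        ((1 + (Polynomial.X : Polynomial ℝ) •
          N.map Polynomial.C).det.divX.divX).eval s * s ^ 2 := by
    intro s
    rw [← Matrix.det_one_add_smul, ← LinearMap.det_toMatrix b]
    congr 1
    simp [N, LinearMap.toMatrix_one]
  simp only [h, LinearMap.trace_eq_matrix_trace ℝ b]
  have hp := ((1 + (Polynomial.X : Polynomial ℝ) •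
    N.map Polynomial.C).det.divX.divX).hasDerivAt (0:ℝ)
  have := (((hasDerivAt_id (0:ℝ)).const_mul N.trace).const_add 1).add
    (hp.mul ((hasDerivAt_id (0:ℝ)).pow 2))
  convert! this using 1
  simp [N]

/-- The derivative of `w ↦ wⁿ` at `w` in the direction of the infinitesimal pull-back
`w(Q ·, ·) + w(·, Q ·)` is `tr Q` times `wⁿ`: this is the derivative of `(A^* w)ⁿ = det A • wⁿ` at
`A = 1`. -/
theorem fderiv_wedgePow_lie {n : ℕ} (w B : (Eucl (2 * n)) [⋀^Fin 2]→L[ℝ] ℝ)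
    (Q : Eucl (2 * n) →L[ℝ] Eucl (2 * n)) (hB : ∀ u v, B ![u, v] = w ![Q u, v] + w ![u, Q v]) :
    fderiv ℝ (fun w : (Eucl (2 * n)) [⋀^Fin 2]→L[ℝ] ℝ => wedgePow w n (stdFrame (2 * n))) w B =
      LinearMap.trace ℝ _ (Q : Eucl (2 * n) →ₗ[ℝ] Eucl (2 * n)) *
        wedgePow w n (stdFrame (2 * n)) := by
  set G := fun w : (Eucl (2 * n)) [⋀^Fin 2]→L[ℝ] ℝ => wedgePow w n (stdFrame (2 * n)) with hG
  let R : (Eucl (2 * n)) [⋀^Fin 2]→L[ℝ] ℝ := w.compContinuousLinearMap Q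
  have hcomp (x y : Eucl (2 * n)) (A : Eucl (2 * n) →L[ℝ] Eucl (2 * n)) :
      A ∘ ![x, y] = ![A x, A y] := by ext1 i; fin_cases i <;> rfl
  have hvec (x : Fin 2 → Eucl (2 * n)) : x = ![x 0, x 1] := by ext1 i; fin_cases i <;> rfl
  have hc : ∀ s : ℝ, w.compContinuousLinearMap (1 + s • Q) = w + s • B + s ^ 2 • R := by
    intro s
    ext x
    rw [hvec x, ContinuousAlternatingMap.compContinuousLinearMap_apply, hcomp]
    simp only [ContinuousAlternatingMap.add_apply, ContinuousAlternatingMap.smul_apply, hB, R,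
      ContinuousAlternatingMap.compContinuousLinearMap_apply, hcomp, add_apply,
      smul_apply, one_apply_eq_self, pair_add_left, pair_add_right,
      pair_smul_left, pair_smul_right, smul_eq_mul]
    ring
  have hcd : HasDerivAt (fun s : ℝ => w + s • B + s ^ 2 • R) B 0 := by
    have := (((hasDerivAt_id (0:ℝ)).smul_const B).const_add w).add
      (((hasDerivAt_id (0:ℝ)).pow 2).smul_const R)
    convert! this using 1
    simp
  have hGd : HasFDerivAt G (fderiv ℝ G w) (w + (0:ℝ) • B + (0:ℝ) ^ 2 • R) := by
    have : w + (0:ℝ) • B + (0:ℝ) ^ 2 • R = w := by simp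
    rw [this]
    exact ((contDiff_wedgePow_apply n _).differentiable (by simp) w).hasFDerivAt
  have h1 := hGd.comp_hasDerivAt (0:ℝ) hcd
  have h2 : G ∘ (fun s : ℝ => w + s • B + s ^ 2 • R) = fun s =>
      LinearMap.det ((1 + s • Q : Eucl (2 * n) →L[ℝ] Eucl (2 * n)) :
        Eucl (2 * n) →ₗ[ℝ] Eucl (2 * n)) * G w := by
    funext s
    simp only [Function.comp, ← hc, hG, wedgePow_compContinuousLinearMap]
    exact map_stdFrame_eq_det (wedgePow w n) (1 + s • Q)
  rw [h2] at h1
  exact h1.unique ((hasDerivAt_det_one_add_smul Q).mul_const _)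

/-! ### Hamiltonian vector fields on a vector space -/

section LocalHamiltonian

variable {V : Type*} [NormedAddCommGroup V] [NormedSpace ℝ V] [FiniteDimensional ℝ V]

/-- The continuous linear map `v ↦ w(v, ·)`. -/
def flatCLM (w : V [⋀^Fin 2]→L[ℝ] ℝ) : V →L[ℝ] V →L[ℝ] ℝ :=
  LinearMap.toContinuousLinearMap
    ((LinearMap.toContinuousLinearMap : (V →ₗ[ℝ] ℝ) ≃ₗ[ℝ] (V →L[ℝ] ℝ)).toLinearMap ∘ₗ
      LinearMap.mk₂ ℝ (fun v u => w ![v, u])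
        (fun _ _ _ => pair_add_left _ _ _ _) (fun _ _ _ => pair_smul_left _ _ _ _)
        (fun _ _ _ => pair_add_right _ _ _ _) (fun _ _ _ => pair_smul_right _ _ _ _))

@[simp] theorem flatCLM_apply (w : V [⋀^Fin 2]→L[ℝ] ℝ) (v u : V) : flatCLM w v u = w ![v, u] := rfl

theorem isInvertible_flatCLM {w : V [⋀^Fin 2]→L[ℝ] ℝ}
    (hw : ∀ v, (∀ u, w ![v, u] = 0) → v = 0) : (flatCLM w).IsInvertible := by
  have hinj : Function.Injective (flatCLM w : V →ₗ[ℝ] V →L[ℝ] ℝ) :=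
    (injective_iff_map_eq_zero _).2 fun v hv => hw v fun u => DFunLike.congr_fun hv u
  have hrank : Module.finrank ℝ V = Module.finrank ℝ (V →L[ℝ] ℝ) := by
    rw [← (LinearMap.toContinuousLinearMap : (V →ₗ[ℝ] ℝ) ≃ₗ[ℝ] (V →L[ℝ] ℝ)).finrank_eq]
    exact Subspace.dual_finrank_eq.symm
  exact ⟨(LinearEquiv.ofInjectiveOfFinrankEq _ hinj hrank).toContinuousLinearEquiv, by ext; rfl⟩

/-- The Hamiltonian vector field of `f` for the 2-form `w` on a vector space: `w(X, ·) = df`. -/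
def localHam (w : V → V [⋀^Fin 2]→L[ℝ] ℝ) (f : V → ℝ) (y : V) : V :=
  (flatCLM (w y)).inverse (fderiv ℝ f y)

theorem localHam_spec {w : V → V [⋀^Fin 2]→L[ℝ] ℝ} {y : V}
    (hw : ∀ v, (∀ u, w y ![v, u] = 0) → v = 0) (f : V → ℝ) (u : V) :
    w y ![localHam w f y, u] = fderiv ℝ f y u := by
  rw [← flatCLM_apply, localHam, (isInvertible_flatCLM hw).self_apply_inverse]

variable {w : V → V [⋀^Fin 2]→L[ℝ] ℝ} {T : Set V}

theorem contDiffOn_localHam (hT : IsOpen T) (hs : ContDiffOn ℝ ∞ w T)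
    (hw : ∀ y ∈ T, ∀ v, (∀ u, w y ![v, u] = 0) → v = 0) {f : V → ℝ} (hf : ContDiffOn ℝ ∞ f T) :
    ContDiffOn ℝ ∞ (localHam w f) T := by
  intro y hy
  have h1 : ContDiffOn ℝ ∞ (fun y => flatCLM (w y)) T := by
    refine contDiffOn_clm_apply.2 fun v => contDiffOn_clm_apply.2 fun u => ?_
    simp only [flatCLM_apply]
    exact (contDiff_eval_alternating _).comp_contDiffOn hs
  have h2 : ContDiffOn ℝ ∞ (fderiv ℝ f) T := hf.fderiv_of_isOpen hT (by simp)
  exact (((isInvertible_flatCLM (hw y hy)).contDiffAt_map_inverse).comp_contDiffWithinAt y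
    (h1 y hy)).clm_apply (h2 y hy)

/-- The Lie derivative of a closed nondegenerate 2-form along a Hamiltonian vector field is zero. -/
theorem lie_localHam (hT : IsOpen T) (hs : ContDiffOn ℝ ∞ w T)
    (hw : ∀ y ∈ T, ∀ v, (∀ u, w y ![v, u] = 0) → v = 0) {f : V → ℝ} (hf : ContDiffOn ℝ ∞ f T)
    {y : V} (hy : y ∈ T) (hd : extDeriv w y = 0) (u v : V) :
    fderiv ℝ w y (localHam w f y) ![u, v] =
      -(w y ![fderiv ℝ (localHam w f) y u, v] + w y ![u, fderiv ℝ (localHam w f) y v]) := by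
  have hTn := hT.mem_nhds hy
  set X := localHam w f with hX
  have hwd : DifferentiableAt ℝ w y := (hs.contDiffAt hTn).differentiableAt (by simp)
  have hXd : DifferentiableAt ℝ X y :=
    ((contDiffOn_localHam hT hs hw hf).contDiffAt hTn).differentiableAt (by simp)
  have hfd : DifferentiableAt ℝ (fderiv ℝ f) y :=
    ((hf.fderiv_of_isOpen hT (m := ∞) (by simp)).contDiffAt hTn).differentiableAt (by simp)
  have hsymm : IsSymmSndFDerivAt ℝ f y := (hf.contDiffAt hTn).isSymmSndFDerivAt (by
    rw [minSmoothness_of_isRCLikeNormedField]; exact WithTop.coe_le_coe.2 le_top)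
  -- differentiating `w(X, v) = df(v)` in the direction `u`
  have key : ∀ u v : V, fderiv ℝ w y u ![X y, v] + w y ![fderiv ℝ X y u, v] =
      fderiv ℝ (fderiv ℝ f) y u v := by
    intro u v
    have h1 : (fun z => w z (fun i => (![X, fun _ => v] : Fin 2 → V → V) i z)) =ᶠ[𝓝 y]
        fun z => fderiv ℝ f z v := by
      filter_upwards [hTn] with z hz
      rw [← localHam_spec (hw z hz)]
      congr 1
      ext1 i; fin_cases i <;> rfl
    have h2 := fderiv_continuousAlternatingMap_apply_apply (g := ![X, fun _ => v]) hwd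
      (by intro i; fin_cases i
          · exact hXd
          · exact differentiableAt_const v) u
    rw [h1.fderiv_eq] at h2
    have h3 : fderiv ℝ (fun z => fderiv ℝ f z v) y u = fderiv ℝ (fderiv ℝ f) y u v := by
      rw [fderiv_clm_apply hfd (differentiableAt_const v)]; simp
    rw [h3] at h2
    rw [h2, Fin.sum_univ_two]
    have e1 : (fun i => (![X, fun _ => v] : Fin 2 → V → V) i y) = ![X y, v] := by
      ext1 i; fin_cases i <;> rfl
    have e2 (a : V) : Function.update ![X y, v] 0 a = ![a, v] := by
      ext1 i; fin_cases i <;> simp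
    have e3 (a : V) : Function.update ![X y, v] 1 a = ![X y, a] := by
      ext1 i; fin_cases i <;> simp
    rw [e1, e2, e3]
    have e4 : w y ![X y, 0] = 0 := by
      have := pair_smul_right (w y) 0 (X y) 0
      simpa using this
    simp [e4]
  have hcl := extDeriv_apply hwd ![X y, u, v]
  rw [hd, Fin.sum_univ_three] at hcl
  have hrem : (Fin.removeNth (0 : Fin 3) ![X y, u, v] = ![u, v]) ∧
      (Fin.removeNth (1 : Fin 3) ![X y, u, v] = ![X y, v]) ∧
      (Fin.removeNth (2 : Fin 3) ![X y, u, v] = ![X y, u]) := by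
    refine ⟨?_, ?_, ?_⟩ <;> · ext1 i; fin_cases i <;> rfl
  have hap (a : V) (c : Fin 2 → V) : fderiv ℝ (fun z => w z c) y a = fderiv ℝ w y a c := by
    rw [fderiv_continuousAlternatingMap_apply_const_apply hwd]
  simp only [hrem, hap] at hcl
  have hanti : w y ![fderiv ℝ X y v, u] = - w y ![u, fderiv ℝ X y v] := by
    have := (w y).toAlternatingMap.map_swap ![u, fderiv ℝ X y v] (i := 0) (j := 1) (by simp)
    have e : ![u, fderiv ℝ X y v] ∘ Equiv.swap (0 : Fin 2) 1 = ![fderiv ℝ X y v, u] := by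
      ext1 i; fin_cases i <;> simp
    rwa [e] at this
  have k1 := key u v
  have k2 := key v u
  have k3 := hsymm u v
  simp at hcl
  linarith

end LocalHamiltonian

section Divergence

/-- The Hamiltonian vector field preserves the top exterior power of the symplectic form:
its coefficient `W` satisfies `dW(X) + W div X = 0`. -/
theorem fderiv_wedgePow_localHam {n : ℕ} {w : Eucl (2 * n) → (Eucl (2 * n)) [⋀^Fin 2]→L[ℝ] ℝ}
    {T : Set (Eucl (2 * n))} (hT : IsOpen T) (hs : ContDiffOn ℝ ∞ w T)
    (hw : ∀ y ∈ T, ∀ v, (∀ u, w y ![v, u] = 0) → v = 0) {f : Eucl (2 * n) → ℝ}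
    (hf : ContDiffOn ℝ ∞ f T) {y : Eucl (2 * n)} (hy : y ∈ T) (hd : extDeriv w y = 0) :
    fderiv ℝ (fun z => wedgePow (w z) n (stdFrame (2 * n))) y (localHam w f y) =
      - (LinearMap.trace ℝ _ (fderiv ℝ (localHam w f) y : Eucl (2 * n) →ₗ[ℝ] Eucl (2 * n)) *
        wedgePow (w y) n (stdFrame (2 * n))) := by
  have hwd : DifferentiableAt ℝ w y := (hs.contDiffAt (hT.mem_nhds hy)).differentiableAt (by simp)
  have h1 := ((contDiff_wedgePow_apply n (stdFrame (2 * n))).differentiable (by simp)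
    (w y)).hasFDerivAt.comp y hwd.hasFDerivAt
  have h2 := fderiv_wedgePow_lie (w y) (-(fderiv ℝ w y (localHam w f y)))
    (fderiv ℝ (localHam w f) y) (fun u v => by
      rw [ContinuousAlternatingMap.neg_apply, lie_localHam hT hs hw hf hy hd, neg_neg])
  rw [map_neg] at h2
  rw [← h2, neg_neg]
  exact congrArg (fun A => A (localHam w f y)) h1.fderiv

/-- The divergence theorem for compactly supported vector fields. -/
theorem integral_trace_fderiv_eq_zero {d : ℕ} {Z : Eucl d → Eucl d} (hZ : ContDiff ℝ 1 Z)
    (hc : HasCompactSupport Z) :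
    ∫ y, LinearMap.trace ℝ _ (fderiv ℝ Z y : Eucl d →ₗ[ℝ] Eucl d) = 0 := by
  have h1 : ∀ y, LinearMap.trace ℝ _ (fderiv ℝ Z y : Eucl d →ₗ[ℝ] Eucl d) =
      ∑ i, fderiv ℝ (fun y => Z y i) y (stdFrame d i) := by
    intro y
    let b := (EuclideanSpace.basisFun (Fin d) ℝ).toBasis
    rw [LinearMap.trace_eq_matrix_trace ℝ b, Matrix.trace]
    refine Finset.sum_congr rfl fun i _ => ?_
    have hd := (hZ.differentiable (by simp) y).hasFDerivAt
    have h2 := ((EuclideanSpace.proj (𝕜 := ℝ) i).hasFDerivAt (x := Z y)).comp y hd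
    have h3 : fderiv ℝ (fun y => Z y i) y = _ := h2.fderiv
    rw [h3]
    simp [b, LinearMap.toMatrix_apply]
  simp only [h1]
  have hcoord : ∀ i, ContDiff ℝ 1 fun y => Z y i := fun i =>
    (EuclideanSpace.proj (𝕜 := ℝ) i).contDiff.comp hZ
  have hcc : ∀ i, HasCompactSupport fun y => Z y i := fun i =>
    hc.comp_left (g := fun z : Eucl d => z i) rfl
  have hi : ∀ i, Integrable fun y => fderiv ℝ (fun y => Z y i) y (stdFrame d i) := fun i =>
    (((hcoord i).continuous_fderiv (by simp)).clm_apply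
      continuous_const).integrable_of_hasCompactSupport
      ((hcc i).fderiv_apply (𝕜 := ℝ) _)
  rw [integral_finsetSum _ fun i _ => hi i]
  refine Finset.sum_eq_zero fun i _ => ?_
  have := integral_mul_fderiv_eq_neg_fderiv_mul_of_integrable (μ := volume) (𝕜 := ℝ)
    (f := fun _ : Eucl d => (1 : ℝ)) (g := fun y => Z y i) (v := stdFrame d i)
    (by simp) (by simpa using hi i)
    (by simpa using (hcoord i).continuous.integrable_of_hasCompactSupport (hcc i))
    (fun _ _ => differentiableAt_const _) (fun y _ => (hcoord i).differentiable (by simp) y)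
  simpa using this

end Divergence

theorem trace_smulRight_eq {V : Type*} [NormedAddCommGroup V] [NormedSpace ℝ V]
    [FiniteDimensional ℝ V] (l : V →L[ℝ] ℝ) (v : V) :
    LinearMap.trace ℝ V (l.smulRight v : V →ₗ[ℝ] V) = l v :=
  LinearMap.trace_smulRight (l : V →ₗ[ℝ] ℝ) v

/-- The derivative of a function along a Hamiltonian vector field that is supported in a compact
subset of the open set `T` has integral zero for the Liouville measure. -/
theorem setIntegral_fderiv_localHam_eq_zero {n : ℕ}
    {w : Eucl (2 * n) → (Eucl (2 * n)) [⋀^Fin 2]→L[ℝ] ℝ}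
    {T : Set (Eucl (2 * n))} (hT : IsOpen T) (hs : ContDiffOn ℝ ∞ w T)
    (hw : ∀ y ∈ T, ∀ v, (∀ u, w y ![v, u] = 0) → v = 0) (hd : ∀ y ∈ T, extDeriv w y = 0)
    (hW : ∀ y ∈ T, wedgePow (w y) n (stdFrame (2 * n)) ≠ 0) {u f : Eucl (2 * n) → ℝ}
    (hu : ContDiffOn ℝ ∞ u T) (hf : ContDiffOn ℝ ∞ f T) {K : Set (Eucl (2 * n))}
    (hK : IsCompact K) (hKT : K ⊆ T) (hfK : ∀ y ∈ T \ K, f y = 0) :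
    ∫ y in T, fderiv ℝ u y (localHam w f y) * |wedgePow (w y) n (stdFrame (2 * n))| = 0 := by
  set W := fun y => wedgePow (w y) n (stdFrame (2 * n)) with hWdef
  set X := localHam w f with hX
  have hWs : ContDiffOn ℝ ∞ W T := (contDiff_wedgePow_apply n _).comp_contDiffOn hs
  have hXs : ContDiffOn ℝ ∞ X T := contDiffOn_localHam hT hs hw hf
  have hX0 : ∀ y ∈ T \ K, X y = 0 := by
    intro y hy
    have : f =ᶠ[𝓝 y] fun _ => 0 := by
      filter_upwards [(hT.sdiff hK.isClosed).mem_nhds hy] with z hz using hfK z hz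
    rw [hX, localHam, this.fderiv_eq]
    simp
  have hnear : ∀ y ∈ T, T.indicator (fun z => (u z * |W z|) • X z) =ᶠ[𝓝 y]
      fun z => (u z * |W z|) • X z := fun y hy => by
    filter_upwards [hT.mem_nhds hy] with z hz using indicator_of_mem hz _
  have hoff : ∀ y ∉ K, T.indicator (fun z => (u z * |W z|) • X z) y = 0 := by
    intro y hy
    by_cases hyT : y ∈ T
    · rw [indicator_of_mem hyT, hX0 y ⟨hyT, hy⟩, smul_zero]
    · exact indicator_of_notMem hyT _
  have hgs : ∀ y ∈ T, ContDiffAt ℝ ∞ (fun z => u z * |W z|) y := fun y hy =>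
    (hu.contDiffAt (hT.mem_nhds hy)).mul
      ((hWs.contDiffAt (hT.mem_nhds hy)).abs (hW y hy))
  have hZ : ContDiff ℝ 1 (T.indicator fun z => (u z * |W z|) • X z) := by
    refine contDiff_iff_contDiffAt.2 fun y => ?_
    by_cases hyT : y ∈ T
    · exact (((hgs y hyT).smul (hXs.contDiffAt (hT.mem_nhds hyT))).of_le (by
        simp)).congr_of_eventuallyEq (hnear y hyT)
    · refine (contDiffAt_const (c := 0)).congr_of_eventuallyEq ?_
      filter_upwards [hK.isClosed.isOpen_compl.mem_nhds fun h => hyT (hKT h)] with z hz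
        using hoff z hz
  have hdiv := integral_trace_fderiv_eq_zero hZ (HasCompactSupport.intro hK hoff)
  rw [← setIntegral_eq_integral_of_forall_compl_eq_zero (s := T)] at hdiv
  · rw [← hdiv]
    refine setIntegral_congr_fun hT.measurableSet fun y hy => ?_
    have hTn := hT.mem_nhds hy
    have hXd : DifferentiableAt ℝ X y := (hXs.contDiffAt hTn).differentiableAt (by simp)
    have hud : DifferentiableAt ℝ u y := (hu.contDiffAt hTn).differentiableAt (by simp)
    have hWd : DifferentiableAt ℝ W y := (hWs.contDiffAt hTn).differentiableAt (by simp)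
    have habs : HasFDerivAt (fun z => |W z|) ((SignType.sign (W y) : ℝ) • fderiv ℝ W y) y :=
      HasDerivAt.comp_hasFDerivAt (h₂ := fun r => |r|) y (hasDerivAt_abs (hW y hy)) hWd.hasFDerivAt
    -- the divergence of `u |W| X` is `du(X) |W|`, since `dW(X) + W div X = 0`
    have hg := (hud.hasFDerivAt.fun_mul habs).fun_smul hXd.hasFDerivAt
    have hkey : fderiv ℝ W y (X y) = _ := fderiv_wedgePow_localHam hT hs hw hf hy (hd y hy)
    rw [(hnear y hy).fderiv_eq, hg.fderiv]
    simp only [ContinuousLinearMap.toLinearMap_add, ContinuousLinearMap.toLinearMap_smul,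
      map_add, map_smul, trace_smulRight_eq, add_apply, smul_apply, smul_eq_mul]
    rw [hkey]
    have hsgn : (SignType.sign (W y) : ℝ) * W y = |W y| := sign_mul_self _
    simp only [hWdef] at hsgn ⊢
    rw [← hsgn]; ring
  · intro y hy
    have : T.indicator (fun z => (u z * |W z|) • X z) =ᶠ[𝓝 y] fun _ => 0 := by
      filter_upwards [hK.isClosed.isOpen_compl.mem_nhds fun h => hy (hKT h)] with z hz
        using hoff z hz
    rw [this.fderiv_eq]
    simp

/-! ### Charts, the symplectic form and the Poisson bracket in charts -/

section Charts

variable {d : ℕ} {M : Type*} [TopologicalSpace M] [ChartedSpace (Eucl d) M]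

theorem isInvertible_mfderiv_extChartAt_symm [IsManifold (𝓡 d) ∞ M] {x₀ : M} {y : Eucl d}
    (hy : y ∈ (extChartAt (𝓡 d) x₀).target) :
    (mfderiv (𝓡 d) (𝓡 d) (extChartAt (𝓡 d) x₀).symm y).IsInvertible := by
  have : IsManifold (𝓡 d) 1 M := IsManifold.of_le (n := ∞) (by simp)
  have h := isInvertible_mfderivWithin_extChartAt_symm hy
  rwa [modelWithCornersSelf_coe, range_id, mfderivWithin_univ] at h

theorem mdifferentiableAt_extChartAt_symm [IsManifold (𝓡 d) ∞ M] {x₀ : M} {y : Eucl d}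
    (hy : y ∈ (extChartAt (𝓡 d) x₀).target) :
    MDifferentiableAt (𝓡 d) (𝓡 d) (extChartAt (𝓡 d) x₀).symm y :=
  (((contMDiffOn_extChartAt_symm (n := ∞) x₀) y hy).contMDiffAt
    ((isOpen_extChartAt_target x₀).mem_nhds hy)).mdifferentiableAt (by simp)

theorem mdifferentiableAt_extChartAt' [IsManifold (𝓡 d) ∞ M] {x₀ x : M}
    (hx : x ∈ (extChartAt (𝓡 d) x₀).source) :
    MDifferentiableAt (𝓡 d) (𝓡 d) (extChartAt (𝓡 d) x₀) x := by
  have : IsManifold (𝓡 d) 1 M := IsManifold.of_le (n := ∞) (by simp)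
  exact mdifferentiableAt_extChartAt (by rwa [extChartAt_source] at hx)

/-- The derivative of an inverse chart, as an endomorphism of the model space. -/
def symmDeriv (x₀ : M) (y : Eucl d) : Eucl d →L[ℝ] Eucl d :=
  mfderiv (𝓡 d) (𝓡 d) (extChartAt (𝓡 d) x₀).symm y

theorem isInvertible_symmDeriv [IsManifold (𝓡 d) ∞ M] {x₀ : M} {y : Eucl d}
    (hy : y ∈ (extChartAt (𝓡 d) x₀).target) : (symmDeriv x₀ y).IsInvertible :=
  isInvertible_mfderiv_extChartAt_symm hy

/-- The determinant of the derivative of an inverse chart, with respect to the standard frames. -/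
def symmDet (x₀ : M) (y : Eucl d) : ℝ :=
  (symmDeriv x₀ y).det

theorem symmDet_ne_zero [IsManifold (𝓡 d) ∞ M] {x₀ : M} {y : Eucl d}
    (hy : y ∈ (extChartAt (𝓡 d) x₀).target) : symmDet x₀ y ≠ 0 := by
  obtain ⟨e, he⟩ := isInvertible_symmDeriv hy
  rw [symmDet, ← he]
  exact (LinearEquiv.isUnit_det' e.toLinearEquiv).ne_zero

theorem inChart_stdFrame (α : DiffForm d M d) (x₀ : M) (y : Eucl d) :
    α.inChart x₀ y (stdFrame d) = symmDet x₀ y * α.coeff ((extChartAt (𝓡 d) x₀).symm y) :=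
  map_stdFrame_eq_det (α ((extChartAt (𝓡 d) x₀).symm y)) _

/-- The transition map between two charts. -/
abbrev chartTransition (x₀ x₁ : M) (y : Eucl d) : Eucl d :=
  extChartAt (𝓡 d) x₁ ((extChartAt (𝓡 d) x₀).symm y)

theorem differentiableAt_chartTransition [IsManifold (𝓡 d) ∞ M] {x₀ x₁ : M} {y : Eucl d}
    (hy : y ∈ (extChartAt (𝓡 d) x₀).target)
    (hy' : (extChartAt (𝓡 d) x₀).symm y ∈ (extChartAt (𝓡 d) x₁).source) :
    DifferentiableAt ℝ (chartTransition x₀ x₁) y :=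
  ((mdifferentiableAt_extChartAt' hy').comp y
    (mdifferentiableAt_extChartAt_symm hy)).differentiableAt

/-- The coordinate change of the frame determinants: the transition map enters with its Jacobian. -/
theorem symmDet_eq_mul [IsManifold (𝓡 d) ∞ M] {x₀ x₁ : M} {y : Eucl d}
    (hy : y ∈ (extChartAt (𝓡 d) x₀).target)
    (hy' : (extChartAt (𝓡 d) x₀).symm y ∈ (extChartAt (𝓡 d) x₁).source) :
    symmDet x₀ y = (fderiv ℝ (chartTransition x₀ x₁) y).det *
      symmDet x₁ (chartTransition x₀ x₁ y) := by
  have hτ : chartTransition x₀ x₁ y ∈ (extChartAt (𝓡 d) x₁).target :=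
    (extChartAt (𝓡 d) x₁).map_source hy'
  have hev : (extChartAt (𝓡 d) x₀).symm =ᶠ[𝓝 y]
      (extChartAt (𝓡 d) x₁).symm ∘ chartTransition x₀ x₁ := by
    have hc : ContinuousAt (extChartAt (𝓡 d) x₀).symm y :=
      (mdifferentiableAt_extChartAt_symm hy).continuousAt
    filter_upwards [hc.preimage_mem_nhds ((isOpen_extChartAt_source x₁).mem_nhds hy')] with z hz
    exact ((extChartAt (𝓡 d) x₁).left_inv hz).symm
  have h1 : mfderiv (𝓡 d) (𝓡 d) (extChartAt (𝓡 d) x₀).symm y =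
      mfderiv (𝓡 d) (𝓡 d) ((extChartAt (𝓡 d) x₁).symm ∘ chartTransition x₀ x₁) y :=
    hev.mfderiv_eq
  rw [mfderiv_comp y (mdifferentiableAt_extChartAt_symm hτ)
    (differentiableAt_chartTransition hy hy').mdifferentiableAt, mfderiv_eq_fderiv] at h1
  have h2 : symmDeriv x₀ y = (symmDeriv x₁ (chartTransition x₀ x₁ y)).comp
      (fderiv ℝ (chartTransition x₀ x₁) y) := h1
  rw [symmDet, h2, mul_comm]
  exact LinearMap.det_comp (M := Eucl d) _ _

end Charts

namespace SymplecticForm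

variable {n : ℕ} {M : Type*} [TopologicalSpace M] [ChartedSpace (Eucl (2 * n)) M]
  (Ω : SymplecticForm n M)

theorem liouvilleForm_inChart (x₀ : M) (y : Eucl (2 * n)) :
    Ω.liouvilleForm.inChart x₀ y = wedgePow (Ω.form.inChart x₀ y) n :=
  (wedgePow_compContinuousLinearMap _ _ n).symm

theorem poissonBracket_eq_mfderiv (u f : M → ℝ) (x : M) :
    Ω.poissonBracket u f x = mfderiv (𝓡 (2 * n)) 𝓘(ℝ, ℝ) u x (Ω.hamVectorField f x) := by
  have h : Ω.flat x (Ω.hamVectorField u x) = _ :=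
    (Ω.flatEquiv x).apply_symm_apply (mfderiv (𝓡 (2 * n)) 𝓘(ℝ, ℝ) u x).toLinearMap
  exact LinearMap.congr_fun h (Ω.hamVectorField f x)

theorem form_hamVectorField (f : M → ℝ) (x : M) (v : TangentSpace (𝓡 (2 * n)) x) :
    Ω.form x ![Ω.hamVectorField f x, v] = mfderiv (𝓡 (2 * n)) 𝓘(ℝ, ℝ) f x v := by
  have h : Ω.flat x (Ω.hamVectorField f x) = _ :=
    (Ω.flatEquiv x).apply_symm_apply (mfderiv (𝓡 (2 * n)) 𝓘(ℝ, ℝ) f x).toLinearMap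
  exact LinearMap.congr_fun h v

theorem inChart_pair (x₀ : M) (y u v : Eucl (2 * n)) :
    Ω.form.inChart x₀ y ![u, v] = Ω.form ((extChartAt (𝓡 (2 * n)) x₀).symm y)
      ![symmDeriv x₀ y u, symmDeriv x₀ y v] := by
  refine congrArg (Ω.form ((extChartAt (𝓡 (2 * n)) x₀).symm y)) ?_
  ext1 i; fin_cases i <;> rfl

variable [IsManifold (𝓡 (2 * n)) ∞ M]

theorem inChart_nondegenerate {x₀ : M} {y : Eucl (2 * n)}
    (hy : y ∈ (extChartAt (𝓡 (2 * n)) x₀).target) (v : Eucl (2 * n))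
    (hv : ∀ u : Eucl (2 * n), Ω.form.inChart x₀ y ![v, u] = 0) : v = 0 := by
  obtain ⟨e, he⟩ := isInvertible_symmDeriv hy
  have h : e v = 0 := by
    refine Ω.nondegenerate ((extChartAt (𝓡 (2 * n)) x₀).symm y) _ fun u => ?_
    have h1 := hv (e.symm u)
    rw [inChart_pair, ← he] at h1
    have h2 : e (e.symm u) = u := e.apply_symm_apply u
    simp only [ContinuousLinearEquiv.coe_coe, h2] at h1
    exact h1
  exact e.map_eq_zero_iff.1 h

/-- The derivative of a function read in a chart. -/
theorem fderiv_comp_symm {x₀ : M} {y : Eucl (2 * n)}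
    (hy : y ∈ (extChartAt (𝓡 (2 * n)) x₀).target) {f : M → ℝ}
    (hf : MDifferentiableAt (𝓡 (2 * n)) 𝓘(ℝ, ℝ) f ((extChartAt (𝓡 (2 * n)) x₀).symm y))
    (v : Eucl (2 * n)) :
    fderiv ℝ (f ∘ (extChartAt (𝓡 (2 * n)) x₀).symm) y v =
      mfderiv (𝓡 (2 * n)) 𝓘(ℝ, ℝ) f ((extChartAt (𝓡 (2 * n)) x₀).symm y) (symmDeriv x₀ y v) := by
  have h2 : fderiv ℝ (f ∘ (extChartAt (𝓡 (2 * n)) x₀).symm) y = _ :=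
    (mfderiv_eq_fderiv (f := f ∘ (extChartAt (𝓡 (2 * n)) x₀).symm)).symm.trans
      (mfderiv_comp y hf (mdifferentiableAt_extChartAt_symm hy))
  rw [h2]
  rfl

/-- The Hamiltonian vector field of `f` on `M` is, in a chart, the Hamiltonian vector field of the
local expression of `f`. -/
theorem symmDeriv_localHam {x₀ : M} {y : Eucl (2 * n)}
    (hy : y ∈ (extChartAt (𝓡 (2 * n)) x₀).target) {f : M → ℝ}
    (hf : MDifferentiableAt (𝓡 (2 * n)) 𝓘(ℝ, ℝ) f ((extChartAt (𝓡 (2 * n)) x₀).symm y)) :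
    symmDeriv x₀ y
      (localHam (Ω.form.inChart x₀) (f ∘ (extChartAt (𝓡 (2 * n)) x₀).symm) y) =
      Ω.hamVectorField f ((extChartAt (𝓡 (2 * n)) x₀).symm y) := by
  obtain ⟨e, he⟩ := isInvertible_symmDeriv hy
  refine (Ω.flat_bijective _).1 (LinearMap.ext fun v => ?_)
  have h1 := localHam_spec (w := Ω.form.inChart x₀) (y := y) (Ω.inChart_nondegenerate hy)
    (f ∘ (extChartAt (𝓡 (2 * n)) x₀).symm) (e.symm v)
  have h3 : symmDeriv x₀ y (e.symm v) = v := by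
    rw [← he]; exact e.apply_symm_apply v
  rw [inChart_pair, fderiv_comp_symm hy hf, h3] at h1
  exact h1.trans (Ω.form_hamVectorField f _ v).symm

/-- The Poisson bracket in a chart, as a derivative along a Hamiltonian vector field. -/
theorem poissonBracket_symm {x₀ : M} {y : Eucl (2 * n)}
    (hy : y ∈ (extChartAt (𝓡 (2 * n)) x₀).target) {u f : M → ℝ}
    (hu : MDifferentiableAt (𝓡 (2 * n)) 𝓘(ℝ, ℝ) u ((extChartAt (𝓡 (2 * n)) x₀).symm y))
    (hf : MDifferentiableAt (𝓡 (2 * n)) 𝓘(ℝ, ℝ) f ((extChartAt (𝓡 (2 * n)) x₀).symm y)) :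
    Ω.poissonBracket u f ((extChartAt (𝓡 (2 * n)) x₀).symm y) =
      fderiv ℝ (u ∘ (extChartAt (𝓡 (2 * n)) x₀).symm) y
        (localHam (Ω.form.inChart x₀) (f ∘ (extChartAt (𝓡 (2 * n)) x₀).symm) y) := by
  rw [poissonBracket_eq_mfderiv, fderiv_comp_symm hy hu, Ω.symmDeriv_localHam hy hf]

end SymplecticForm

/-! ### The Liouville measure -/

namespace SymplecticForm

variable {n : ℕ} {M : Type*} [TopologicalSpace M] [ChartedSpace (Eucl (2 * n)) M]
  (Ω : SymplecticForm n M)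

theorem contDiffOn_liouville_inChart (x₀ : M) :
    ContDiffOn ℝ ∞ (fun y => Ω.liouvilleForm.inChart x₀ y (stdFrame (2 * n)))
      (extChartAt (𝓡 (2 * n)) x₀).target := by
  simp only [liouvilleForm_inChart]
  exact (contDiff_wedgePow_apply n _).comp_contDiffOn (Ω.smooth x₀)

/-- The absolute value of the coefficient of `ωⁿ` in a chart, as a density. -/
def chartDensity (x₀ : M) (y : Eucl (2 * n)) : ENNReal :=
  ENNReal.ofReal |Ω.liouvilleForm.inChart x₀ y (stdFrame (2 * n))|

theorem aemeasurable_chartDensity (x₀ : M) :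
    AEMeasurable (Ω.chartDensity x₀) (volume.restrict (extChartAt (𝓡 (2 * n)) x₀).target) :=
  ((Ω.contDiffOn_liouville_inChart x₀).continuousOn.abs.aemeasurable
    (isOpen_extChartAt_target x₀).measurableSet).ennreal_ofReal

variable [MeasurableSpace M]

/-- The Liouville measure of the domain of one chart, extended by zero. -/
def chartMeasure (x₀ : M) : Measure M :=
  Measure.map (extChartAt (𝓡 (2 * n)) x₀).symm
    ((volume.restrict (extChartAt (𝓡 (2 * n)) x₀).target).withDensity (Ω.chartDensity x₀))

theorem liouvilleMeasure_eq_iSup : Ω.liouvilleMeasure = ⨆ x₀, Ω.chartMeasure x₀ := rfl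

variable [BorelSpace M]

theorem aemeasurable_extChartAt_symm (x₀ : M) :
    AEMeasurable (extChartAt (𝓡 (2 * n)) x₀).symm
      ((volume.restrict (extChartAt (𝓡 (2 * n)) x₀).target).withDensity (Ω.chartDensity x₀)) :=
  ((continuousOn_extChartAt_symm x₀).aemeasurable
    (isOpen_extChartAt_target x₀).measurableSet).mono_ac (withDensity_absolutelyContinuous _ _)

omit Ω in
theorem measurableSet_target_inter_preimage (x₀ : M) {S : Set M} (hS : MeasurableSet S) :
    MeasurableSet ((extChartAt (𝓡 (2 * n)) x₀).target ∩
      (extChartAt (𝓡 (2 * n)) x₀).symm ⁻¹' S) := by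
  have h : Measurable fun y : (extChartAt (𝓡 (2 * n)) x₀).target =>
      (extChartAt (𝓡 (2 * n)) x₀).symm y :=
    (continuousOn_iff_continuous_domRestrict.1 (continuousOn_extChartAt_symm x₀)).measurable
  have := (isOpen_extChartAt_target (I := 𝓡 (2 * n)) x₀).measurableSet.subtype_image (h hS)
  convert this using 1
  ext y
  constructor
  · exact fun hy => ⟨⟨y, hy.1⟩, hy.2, rfl⟩
  · rintro ⟨z, hz, rfl⟩
    exact ⟨z.2, hz⟩

theorem chartMeasure_apply (x₀ : M) {S : Set M} (hS : MeasurableSet S) :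
    Ω.chartMeasure x₀ S = ∫⁻ y in (extChartAt (𝓡 (2 * n)) x₀).target ∩
      (extChartAt (𝓡 (2 * n)) x₀).symm ⁻¹' S, Ω.chartDensity x₀ y := by
  have hT := (isOpen_extChartAt_target (I := 𝓡 (2 * n)) x₀).measurableSet
  rw [chartMeasure, Measure.map_apply_of_aemeasurable (Ω.aemeasurable_extChartAt_symm x₀) hS,
    ← restrict_withDensity hT, Measure.restrict_apply' hT, inter_comm,
    withDensity_apply _ (measurableSet_target_inter_preimage x₀ hS)]

variable [IsManifold (𝓡 (2 * n)) ∞ M]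

/-- The local Liouville measures agree on the overlaps of charts. -/
theorem chartMeasure_eq_on_overlap (x₀ x₁ : M) {S : Set M} (hS : MeasurableSet S)
    (h0 : S ⊆ (extChartAt (𝓡 (2 * n)) x₀).source) (h1 : S ⊆ (extChartAt (𝓡 (2 * n)) x₁).source) :
    Ω.chartMeasure x₀ S = Ω.chartMeasure x₁ S := by
  rw [chartMeasure_apply _ _ hS, chartMeasure_apply _ _ hS]
  set φ := extChartAt (𝓡 (2 * n)) x₀ with hφ
  set ψ := extChartAt (𝓡 (2 * n)) x₁ with hψ
  have himg : ψ.target ∩ ψ.symm ⁻¹' S = chartTransition x₀ x₁ '' (φ.target ∩ φ.symm ⁻¹' S) := by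
    ext z
    constructor
    · rintro ⟨hz, hzS⟩
      have hzS' : ψ.symm z ∈ S := hzS
      have hl : φ.symm (φ (ψ.symm z)) = ψ.symm z := φ.left_inv (h0 hzS')
      refine ⟨φ (ψ.symm z), ⟨φ.map_source (h0 hzS'), by rwa [mem_preimage, hl]⟩, ?_⟩
      rw [chartTransition, ← hφ, ← hψ, hl, ψ.right_inv hz]
    · rintro ⟨y, ⟨_, hyS⟩, rfl⟩
      refine ⟨ψ.map_source (h1 hyS), ?_⟩
      have hl : ψ.symm (chartTransition x₀ x₁ y) = φ.symm y := ψ.left_inv (h1 hyS)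
      rw [mem_preimage, hl]
      exact hyS
  rw [himg, lintegral_image_eq_lintegral_abs_det_fderiv_mul volume
    (measurableSet_target_inter_preimage x₀ hS)
    (f' := fun y => fderiv ℝ (chartTransition x₀ x₁) y)]
  · refine setLIntegral_congr_fun (measurableSet_target_inter_preimage x₀ hS) fun y hy => ?_
    have hl : ψ.symm (chartTransition x₀ x₁ y) = φ.symm y := ψ.left_inv (h1 hy.2)
    simp only [chartDensity]
    rw [← ENNReal.ofReal_mul (abs_nonneg _), ← abs_mul, inChart_stdFrame, inChart_stdFrame,
      symmDet_eq_mul hy.1 (h1 hy.2), ← hφ, ← hψ, hl, mul_assoc]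
  · intro y hy
    exact (differentiableAt_chartTransition hy.1 (h1 hy.2)).hasFDerivAt.hasFDerivWithinAt
  · intro y hy z hz hyz
    have : φ.symm y = φ.symm z := ψ.injOn (h1 hy.2) (h1 hz.2) hyz
    exact φ.symm.injOn hy.1 hz.1 this

/-- On the domain of a chart, the Liouville measure is the one defined by this chart. -/
theorem liouvilleMeasure_restrict_source (x₀ : M) :
    Ω.liouvilleMeasure.restrict (extChartAt (𝓡 (2 * n)) x₀).source = Ω.chartMeasure x₀ := by
  have hU (x : M) : MeasurableSet (extChartAt (𝓡 (2 * n)) x).source :=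
    (isOpen_extChartAt_source x).measurableSet
  have hconc : ∀ (x : M) {S : Set M}, MeasurableSet S →
      Ω.chartMeasure x S = Ω.chartMeasure x (S ∩ (extChartAt (𝓡 (2 * n)) x).source) := by
    intro x S hS
    rw [chartMeasure_apply _ _ hS, chartMeasure_apply _ _ (hS.inter (hU x))]
    congr 2
    ext y
    simp only [mem_inter_iff, mem_preimage]
    exact ⟨fun h => ⟨h.1, h.2, (extChartAt (𝓡 (2 * n)) x).map_target h.1⟩, fun h => ⟨h.1, h.2.1⟩⟩
  have hle : ∀ x, (Ω.chartMeasure x).restrict (extChartAt (𝓡 (2 * n)) x₀).source ≤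
      Ω.chartMeasure x₀ := by
    refine fun x => Measure.le_iff.2 fun S hS => ?_
    rw [Measure.restrict_apply hS, hconc x (hS.inter (hU x₀)),
      Ω.chartMeasure_eq_on_overlap x x₀ ((hS.inter (hU x₀)).inter (hU x)) inter_subset_right
        (inter_subset_left.trans inter_subset_right)]
    exact measure_mono (inter_subset_left.trans inter_subset_left)
  have hself : (Ω.chartMeasure x₀).restrict (extChartAt (𝓡 (2 * n)) x₀).source =
      Ω.chartMeasure x₀ := by
    ext S hS
    rw [Measure.restrict_apply hS, ← hconc x₀ hS]
  refine le_antisymm ?_ ?_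
  · -- an upper bound of all local measures which equals `chartMeasure x₀` on the chart domain
    have hub : Ω.liouvilleMeasure ≤ Ω.chartMeasure x₀ +
        Ω.liouvilleMeasure.restrict (extChartAt (𝓡 (2 * n)) x₀).sourceᶜ := by
      rw [liouvilleMeasure_eq_iSup]
      refine iSup_le fun x => ?_
      rw [← Measure.restrict_add_restrict_compl (μ := Ω.chartMeasure x) (hU x₀)]
      exact add_le_add (hle x) (Measure.restrict_mono_measure (le_iSup Ω.chartMeasure x) _)
    refine (Measure.restrict_mono_measure hub _).trans ?_
    rw [Measure.restrict_add, Measure.restrict_restrict (hU x₀), inter_compl_self,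
      Measure.restrict_empty, add_zero, hself]
  · rw [← hself, liouvilleMeasure_eq_iSup]
    exact Measure.restrict_mono_measure (le_iSup Ω.chartMeasure x₀) _

instance isLocallyFiniteMeasure_liouvilleMeasure : IsLocallyFiniteMeasure Ω.liouvilleMeasure := by
  refine ⟨fun x => ?_⟩
  set φ := extChartAt (𝓡 (2 * n)) x with hφ
  have hT : IsOpen φ.target := isOpen_extChartAt_target x
  have hc : ContinuousAt (fun y => |Ω.liouvilleForm.inChart x y (stdFrame (2 * n))|) (φ x) :=
    ((Ω.contDiffOn_liouville_inChart x).continuousOn.continuousAt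
      (hT.mem_nhds (mem_extChartAt_target x))).abs
  set C := |Ω.liouvilleForm.inChart x (φ x) (stdFrame (2 * n))| + 1 with hC
  have hev : ∀ᶠ y in 𝓝 (φ x), |Ω.liouvilleForm.inChart x y (stdFrame (2 * n))| < C :=
    hc.eventually_lt_const (by simp [hC])
  obtain ⟨r, hr, hball⟩ := Metric.eventually_nhds_iff_ball.1 hev
  have hNo : IsOpen (φ.source ∩ φ ⁻¹' Metric.ball (φ x) r) :=
    isOpen_extChartAt_preimage' x Metric.isOpen_ball
  refine ⟨φ.source ∩ φ ⁻¹' Metric.ball (φ x) r, hNo.mem_nhds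
    ⟨mem_extChartAt_source x, Metric.mem_ball_self hr⟩, ?_⟩
  have h1 : Ω.liouvilleMeasure (φ.source ∩ φ ⁻¹' Metric.ball (φ x) r) =
      Ω.chartMeasure x (φ.source ∩ φ ⁻¹' Metric.ball (φ x) r) := by
    rw [← liouvilleMeasure_restrict_source, Measure.restrict_apply hNo.measurableSet,
      inter_eq_left.2 inter_subset_left]
  rw [h1, chartMeasure_apply _ _ hNo.measurableSet]
  calc _ ≤ ∫⁻ y in Metric.ball (φ x) r, ENNReal.ofReal C := by
        refine (lintegral_mono_set fun y hy => ?_).trans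
          (setLIntegral_mono measurable_const fun y hy => ?_)
        · have := hy.2.2
          rwa [mem_preimage, φ.right_inv hy.1] at this
        · exact ENNReal.ofReal_le_ofReal (hball y hy).le
    _ < ⊤ := by
        rw [setLIntegral_const]
        exact ENNReal.mul_lt_top ENNReal.ofReal_lt_top measure_ball_lt_top

/-- Integration in a chart. -/
theorem integral_eq_setIntegral_chart (x₀ : M) {g : M → ℝ}
    (hg : ContinuousOn g (extChartAt (𝓡 (2 * n)) x₀).source)
    (hg0 : ∀ x ∉ (extChartAt (𝓡 (2 * n)) x₀).source, g x = 0) :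
    ∫ x, g x ∂Ω.liouvilleMeasure = ∫ y in (extChartAt (𝓡 (2 * n)) x₀).target,
      g ((extChartAt (𝓡 (2 * n)) x₀).symm y) *
        |Ω.liouvilleForm.inChart x₀ y (stdFrame (2 * n))| := by
  rw [← setIntegral_eq_integral_of_forall_compl_eq_zero (s := (extChartAt (𝓡 (2 * n)) x₀).source)
    (fun x hx => hg0 x hx)]
  have hm : AEStronglyMeasurable g (Ω.chartMeasure x₀) := by
    rw [← liouvilleMeasure_restrict_source]
    exact hg.aestronglyMeasurable (isOpen_extChartAt_source x₀).measurableSet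
  rw [liouvilleMeasure_restrict_source, chartMeasure,
    integral_map (Ω.aemeasurable_extChartAt_symm x₀) hm,
    integral_withDensity_eq_integral_toReal_smul₀ (Ω.aemeasurable_chartDensity x₀)
      (Filter.Eventually.of_forall fun _ => ENNReal.ofReal_lt_top)]
  refine integral_congr_ae (Filter.Eventually.of_forall fun y => ?_)
  simp only [chartDensity]
  rw [ENNReal.toReal_ofReal (abs_nonneg _), smul_eq_mul, mul_comm]

end SymplecticForm

/-! ### Integrals of Poisson brackets -/

theorem ContMDiff.contDiffOn_comp_symm {d : ℕ} {M : Type*} [TopologicalSpace M]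
    [ChartedSpace (Eucl d) M] [IsManifold (𝓡 d) ∞ M] {f : M → ℝ}
    (hf : ContMDiff (𝓡 d) 𝓘(ℝ, ℝ) ∞ f) (x₀ : M) :
    ContDiffOn ℝ ∞ (f ∘ (extChartAt (𝓡 d) x₀).symm) (extChartAt (𝓡 d) x₀).target :=
  contMDiffOn_iff_contDiffOn.1 (hf.comp_contMDiffOn (contMDiffOn_extChartAt_symm x₀))

namespace SymplecticForm

variable {n : ℕ} {M : Type*} [TopologicalSpace M] [ChartedSpace (Eucl (2 * n)) M]
  (Ω : SymplecticForm n M)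

theorem liouville_inChart_ne_zero [IsManifold (𝓡 (2 * n)) ∞ M]
    (hW : ∀ x, Ω.liouvilleForm.coeff x ≠ 0) {x₀ : M} {y : Eucl (2 * n)}
    (hy : y ∈ (extChartAt (𝓡 (2 * n)) x₀).target) :
    Ω.liouvilleForm.inChart x₀ y (stdFrame (2 * n)) ≠ 0 := by
  rw [inChart_stdFrame]
  exact mul_ne_zero (symmDet_ne_zero hy) (hW _)

theorem poissonBracket_add_right (u : M → ℝ) {f g : M → ℝ} {x : M}
    (hf : MDifferentiableAt (𝓡 (2 * n)) 𝓘(ℝ, ℝ) f x)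
    (hg : MDifferentiableAt (𝓡 (2 * n)) 𝓘(ℝ, ℝ) g x) :
    Ω.poissonBracket u (f + g) x = Ω.poissonBracket u f x + Ω.poissonBracket u g x := by
  have h : Ω.hamVectorField (f + g) x = Ω.hamVectorField f x + Ω.hamVectorField g x := by
    refine (Ω.flat_bijective x).1 (LinearMap.ext fun v => ?_)
    rw [map_add]
    have h1 := mfderiv_add hf hg
    have h2 : Ω.form x ![Ω.hamVectorField (f + g) x, v] =
        Ω.form x ![Ω.hamVectorField f x, v] + Ω.form x ![Ω.hamVectorField g x, v] := by
      rw [form_hamVectorField, form_hamVectorField, form_hamVectorField]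
      exact DFunLike.congr_fun h1 v
    exact h2
  rw [poissonBracket_eq_mfderiv, h, map_add, poissonBracket_eq_mfderiv, poissonBracket_eq_mfderiv]
  rfl

theorem poissonBracket_eq_zero_of_eventuallyEq (u : M → ℝ) {f : M → ℝ} {x : M}
    (hf : f =ᶠ[𝓝 x] fun _ => 0) : Ω.poissonBracket u f x = 0 := by
  have h : Ω.hamVectorField f x = 0 := by
    rw [hamVectorField, hf.mfderiv_eq, mfderiv_const]
    exact map_zero _
  rw [poissonBracket_eq_mfderiv, h]
  exact map_zero _

variable [IsManifold (𝓡 (2 * n)) ∞ M]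

theorem poissonBracket_comp_left {φ : ℝ → ℝ} (hφ : ContDiff ℝ ∞ φ) {u f : M → ℝ}
    (hu : ContMDiff (𝓡 (2 * n)) 𝓘(ℝ, ℝ) ∞ u) (hf : ContMDiff (𝓡 (2 * n)) 𝓘(ℝ, ℝ) ∞ f) (x : M) :
    Ω.poissonBracket (φ ∘ u) f x = deriv φ (u x) * Ω.poissonBracket u f x := by
  have hx : (extChartAt (𝓡 (2 * n)) x).symm (extChartAt (𝓡 (2 * n)) x x) = x :=
    extChartAt_to_inv x
  have ht := mem_extChartAt_target (I := 𝓡 (2 * n)) x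
  have hφu : ContMDiff (𝓡 (2 * n)) 𝓘(ℝ, ℝ) ∞ (φ ∘ u) := hφ.contMDiff.comp hu
  have hud := (((hu.contDiffOn_comp_symm x).contDiffAt
    ((isOpen_extChartAt_target x).mem_nhds ht)).differentiableAt (by simp)).hasFDerivAt
  have h1 := Ω.poissonBracket_symm ht (hφu.mdifferentiableAt (by simp))
    (hf.mdifferentiableAt (by simp))
  have h2 := Ω.poissonBracket_symm ht (hu.mdifferentiableAt (by simp))
    (hf.mdifferentiableAt (by simp))
  have h3 := HasDerivAt.comp_hasFDerivAt (h₂ := φ) _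
    ((hφ.differentiable (by simp) _).hasDerivAt) hud
  rw [hx] at h1 h2
  rw [h1, h2, Function.comp_assoc, h3.fderiv]
  simp

theorem continuous_poissonBracket {u f : M → ℝ}
    (hu : ContMDiff (𝓡 (2 * n)) 𝓘(ℝ, ℝ) ∞ u) (hf : ContMDiff (𝓡 (2 * n)) 𝓘(ℝ, ℝ) ∞ f) :
    Continuous (Ω.poissonBracket u f) := by
  refine continuous_iff_continuousAt.2 fun x => ?_
  have hT := isOpen_extChartAt_target (I := 𝓡 (2 * n)) x
  have h1 : ContinuousOn (fun y => fderiv ℝ (u ∘ (extChartAt (𝓡 (2 * n)) x).symm) y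
      (localHam (Ω.form.inChart x) (f ∘ (extChartAt (𝓡 (2 * n)) x).symm) y))
      (extChartAt (𝓡 (2 * n)) x).target :=
    (((hu.contDiffOn_comp_symm x).continuousOn_fderiv_of_isOpen hT (by simp)).clm_apply
      (contDiffOn_localHam hT (Ω.smooth x) (fun y hy => Ω.inChart_nondegenerate hy)
        (hf.contDiffOn_comp_symm x)).continuousOn)
  have h2 := (h1.comp (continuousOn_extChartAt (I := 𝓡 (2 * n)) x)
    fun z hz => (extChartAt (𝓡 (2 * n)) x).map_source hz).continuousAt
      (extChartAt_source_mem_nhds (I := 𝓡 (2 * n)) x)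
  refine h2.congr ?_
  filter_upwards [extChartAt_source_mem_nhds (I := 𝓡 (2 * n)) x] with z hz
  have h3 := Ω.poissonBracket_symm ((extChartAt (𝓡 (2 * n)) x).map_source hz)
    (hu.mdifferentiableAt (by simp)) (hf.mdifferentiableAt (by simp))
  rw [(extChartAt (𝓡 (2 * n)) x).left_inv hz] at h3
  exact h3.symm

variable [MeasurableSpace M] [BorelSpace M] [CompactSpace M]

theorem _root_.Continuous.integrable_liouville {g : M → ℝ} (hg : Continuous g) :
    Integrable g Ω.liouvilleMeasure :=
  hg.integrable_of_hasCompactSupport (HasCompactSupport.of_compactSpace g)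

/-- Liouville's theorem for a Hamiltonian supported in the domain of a chart. -/
theorem integral_poissonBracket_of_tsupport_subset (hW : ∀ x, Ω.liouvilleForm.coeff x ≠ 0)
    {u f : M → ℝ} (hu : ContMDiff (𝓡 (2 * n)) 𝓘(ℝ, ℝ) ∞ u)
    (hf : ContMDiff (𝓡 (2 * n)) 𝓘(ℝ, ℝ) ∞ f) {x₀ : M}
    (hs : tsupport f ⊆ (extChartAt (𝓡 (2 * n)) x₀).source) :
    ∫ x, Ω.poissonBracket u f x ∂Ω.liouvilleMeasure = 0 := by
  have hT := isOpen_extChartAt_target (I := 𝓡 (2 * n)) x₀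
  rw [Ω.integral_eq_setIntegral_chart x₀ (Ω.continuous_poissonBracket hu hf).continuousOn
    fun x hx => Ω.poissonBracket_eq_zero_of_eventuallyEq u
      (notMem_tsupport_iff_eventuallyEq.1 fun h => hx (hs h))]
  have hK : IsCompact (extChartAt (𝓡 (2 * n)) x₀ '' tsupport f) :=
    (isClosed_tsupport f).isCompact.image_of_continuousOn ((continuousOn_extChartAt x₀).mono hs)
  have h := setIntegral_fderiv_localHam_eq_zero hT (Ω.smooth x₀)
    (fun y hy => Ω.inChart_nondegenerate hy) (Ω.closed x₀)
    (fun y hy => by rw [← liouvilleForm_inChart]; exact Ω.liouville_inChart_ne_zero hW hy)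
    (hu.contDiffOn_comp_symm x₀) (hf.contDiffOn_comp_symm x₀) hK
    (by rintro _ ⟨x, hx, rfl⟩; exact (extChartAt (𝓡 (2 * n)) x₀).map_source (hs hx))
    (by
      rintro y ⟨hy, hyK⟩
      by_contra h0
      exact hyK ⟨_, subset_tsupport f h0, (extChartAt (𝓡 (2 * n)) x₀).right_inv hy⟩)
  rw [← h]
  refine setIntegral_congr_fun hT.measurableSet fun y hy => ?_
  simp only [liouvilleForm_inChart]
  rw [Ω.poissonBracket_symm hy (hu.mdifferentiableAt (by simp)) (hf.mdifferentiableAt (by simp))]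

/-- Liouville's theorem: Poisson brackets have integral zero. -/
theorem integral_poissonBracket_eq_zero [T2Space M] (hW : ∀ x, Ω.liouvilleForm.coeff x ≠ 0)
    {u f : M → ℝ} (hu : ContMDiff (𝓡 (2 * n)) 𝓘(ℝ, ℝ) ∞ u)
    (hf : ContMDiff (𝓡 (2 * n)) 𝓘(ℝ, ℝ) ∞ f) :
    ∫ x, Ω.poissonBracket u f x ∂Ω.liouvilleMeasure = 0 := by
  obtain ⟨χ, hχ⟩ := SmoothPartitionOfUnity.exists_isSubordinate_chartAt_source (𝓡 (2 * n)) M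
  have hfin : {i | (Function.support (χ i)).Nonempty}.Finite :=
    χ.locallyFinite.finite_nonempty_of_compact
  have hg (i : M) : ContMDiff (𝓡 (2 * n)) 𝓘(ℝ, ℝ) ∞ fun x => χ i x * f x :=
    (χ i).contMDiff.mul hf
  have hsum : ∀ s : Finset M, ContMDiff (𝓡 (2 * n)) 𝓘(ℝ, ℝ) ∞ (∑ i ∈ s, fun x => χ i x * f x) ∧
      ∫ x, Ω.poissonBracket u (∑ i ∈ s, fun x => χ i x * f x) x ∂Ω.liouvilleMeasure = 0 := by
    classical
    intro s
    induction s using Finset.induction_on with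
    | empty =>
      rw [Finset.sum_empty]
      refine ⟨contMDiff_const, ?_⟩
      simp [Ω.poissonBracket_eq_zero_of_eventuallyEq u (f := 0) (Filter.EventuallyEq.refl _ _)]
    | insert i s his ih =>
      rw [Finset.sum_insert his]
      refine ⟨(hg i).add ih.1, ?_⟩
      have h1 : Ω.poissonBracket u ((fun x => χ i x * f x) + ∑ i ∈ s, fun x => χ i x * f x) =
          fun x => Ω.poissonBracket u (fun x => χ i x * f x) x +
            Ω.poissonBracket u (∑ i ∈ s, fun x => χ i x * f x) x := funext fun x =>
        Ω.poissonBracket_add_right u ((hg i).mdifferentiableAt (by simp))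
          (ih.1.mdifferentiableAt (by simp))
      rw [h1, integral_add ((Ω.continuous_poissonBracket hu (hg i)).integrable_liouville Ω)
        ((Ω.continuous_poissonBracket hu ih.1).integrable_liouville Ω), ih.2, add_zero]
      refine Ω.integral_poissonBracket_of_tsupport_subset hW hu (hg i) (x₀ := i) ?_
      rw [extChartAt_source]
      exact (tsupport_mul_subset_left).trans (hχ i)
  have hf' : f = ∑ i ∈ hfin.toFinset, fun x => χ i x * f x := by
    funext x
    rw [Finset.sum_apply, ← Finset.sum_mul]
    have h1 := χ.sum_eq_one (mem_univ x)
    rw [finsum_eq_sum_of_support_subset (s := hfin.toFinset)] at h1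
    · rw [h1, one_mul]
    · intro i hi
      exact hfin.mem_toFinset.2 ⟨x, hi⟩
  rw [hf']
  exact (hsum _).2

end SymplecticForm

/-! ### Smooth curves of densities and conserved functionals -/

theorem hasDerivAt_integral_of_continuous {X : Type*} [TopologicalSpace X] [CompactSpace X]
    [MeasurableSpace X] [OpensMeasurableSpace X] (μ : Measure X) [IsFiniteMeasure μ]
    {F F' : ℝ → X → ℝ} (hF : Continuous fun p : ℝ × X => F p.1 p.2)
    (hF' : Continuous fun p : ℝ × X => F' p.1 p.2)
    (h : ∀ t x, HasDerivAt (fun s => F s x) (F' t x) t) (t : ℝ) :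
    HasDerivAt (fun s => ∫ x, F s x ∂μ) (∫ x, F' t x ∂μ) t := by
  have hs (s : ℝ) : Continuous (F s) := hF.comp (by fun_prop : Continuous fun x : X => (s, x))
  have hs' (s : ℝ) : Continuous (F' s) := hF'.comp (by fun_prop : Continuous fun x : X => (s, x))
  obtain ⟨C, hC⟩ := ((isCompact_Icc (a := t - 1) (b := t + 1)).prod
    (isCompact_univ (X := X))).exists_bound_of_continuousOn hF'.continuousOn
  refine (hasDerivAt_integral_of_dominated_loc_of_deriv_le (bound := fun _ => C)
    (s := Ioo (t - 1) (t + 1)) (Ioo_mem_nhds (by linarith) (by linarith))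
    (Filter.Eventually.of_forall fun s => (hs s).aestronglyMeasurable)
    ((hs t).integrable_of_hasCompactSupport (HasCompactSupport.of_compactSpace _))
    (hs' t).aestronglyMeasurable
    (Filter.Eventually.of_forall fun x s hst => hC (s, x) ⟨Ioo_subset_Icc_self hst, mem_univ x⟩)
    (integrable_const C)
    (Filter.Eventually.of_forall fun x s _ => h s x)).2

theorem contMDiff_of_contDiffOn_comp_symm {d : ℕ} {M : Type*} [TopologicalSpace M]
    [ChartedSpace (Eucl d) M] [IsManifold (𝓡 d) ∞ M] {f : M → ℝ}
    (hf : ∀ x₀, ContDiffOn ℝ ∞ (f ∘ (extChartAt (𝓡 d) x₀).symm) (extChartAt (𝓡 d) x₀).target) :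
    ContMDiff (𝓡 d) 𝓘(ℝ, ℝ) ∞ f := by
  intro x
  have hat := (hf x).contDiffAt ((isOpen_extChartAt_target x).mem_nhds (mem_extChartAt_target x))
  have h1 := hat.contMDiffAt.comp x (contMDiffAt_extChartAt (I := 𝓡 d) (n := ∞) (x := x))
  refine h1.congr_of_eventuallyEq ?_
  filter_upwards [extChartAt_source_mem_nhds (I := 𝓡 d) x] with z hz
  simp only [Function.comp_apply]
  rw [(extChartAt (𝓡 d) x).left_inv hz]

namespace SymplecticForm

variable {n : ℕ} {M : Type*} [TopologicalSpace M] [ChartedSpace (Eucl (2 * n)) M]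
  (Ω : SymplecticForm n M)

theorem ratio_smul_fun (f : M → ℝ) (α : DiffForm (2 * n) M (2 * n)) (x : M) :
    Ω.ratio (fun x => f x • α x) x = f x * Ω.ratio α x :=
  mul_div_assoc _ _ _

theorem ratio_casimirForm [MeasurableSpace M] (hW : ∀ x, Ω.liouvilleForm.coeff x ≠ 0) (h : ℝ → ℝ)
    (ν : Ω.Dens) : Ω.ratio (Ω.casimirForm h ν) = fun x => h (Ω.ratio ν.form x) := by
  funext x
  refine (Ω.ratio_smul_fun _ _ x).trans ?_
  have h1 : Ω.ratio Ω.liouvilleForm x = 1 := div_self (hW x)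
  rw [h1, mul_one]

/-- A density is at every point a positive multiple of `ωⁿ`; so `ωⁿ` vanishes nowhere as soon as
there is a density. -/
theorem Dens.liouville_coeff_ne_zero [MeasurableSpace M] {Ω : SymplecticForm n M} (ν : Ω.Dens)
    (x : M) : Ω.liouvilleForm.coeff x ≠ 0 := by
  intro h
  have := ν.2.2.1 x
  rw [ratio, h, div_zero] at this
  exact this.false

theorem casimir_eq_integral [MeasurableSpace M] (h : ℝ → ℝ) (ν : Ω.Dens) :
    Ω.casimir h ν = ∫ x, h (Ω.ratio ν.form x) ∂Ω.liouvilleMeasure := by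
  rw [casimir, integral, ratio_casimirForm Ω ν.liouville_coeff_ne_zero]

theorem linFunctional_eq_integral [MeasurableSpace M] (f : M → ℝ) (ν : Ω.Dens) :
    Ω.linFunctional f ν = ∫ x, f x * Ω.ratio ν.form x ∂Ω.liouvilleMeasure := by
  rw [linFunctional, integral]
  simp only [ratio_smul_fun]

theorem HasVelocityAt.hasDerivAt_ratio [MeasurableSpace M] {Ω : SymplecticForm n M}
    {γ : ℝ → Ω.Dens} {β : DiffForm (2 * n) M (2 * n)} {t : ℝ} (h : HasVelocityAt γ β t) (x : M) :
    HasDerivAt (fun s => Ω.ratio (γ s).form x) (Ω.ratio β x) t :=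
  (h x _).div_const _

variable [IsManifold (𝓡 (2 * n)) ∞ M]

/-- The quotient by `ωⁿ` may be computed in any chart, as the Jacobians cancel. -/
theorem ratio_symm (α : DiffForm (2 * n) M (2 * n)) {x₀ : M} {y : Eucl (2 * n)}
    (hy : y ∈ (extChartAt (𝓡 (2 * n)) x₀).target) :
    Ω.ratio α ((extChartAt (𝓡 (2 * n)) x₀).symm y) =
      α.inChart x₀ y (stdFrame (2 * n)) / Ω.liouvilleForm.inChart x₀ y (stdFrame (2 * n)) := by
  rw [inChart_stdFrame, inChart_stdFrame, mul_div_mul_left _ _ (symmDet_ne_zero hy), ratio]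

theorem contMDiff_ratio (hW : ∀ x, Ω.liouvilleForm.coeff x ≠ 0) {α : DiffForm (2 * n) M (2 * n)}
    (hα : α.IsSmooth) : ContMDiff (𝓡 (2 * n)) 𝓘(ℝ, ℝ) ∞ (Ω.ratio α) := by
  refine contMDiff_of_contDiffOn_comp_symm fun x₀ => ?_
  refine ContDiffOn.congr ?_ fun y hy => Ω.ratio_symm α hy
  exact ((contDiff_eval_alternating _).comp_contDiffOn (hα x₀)).div
    (Ω.contDiffOn_liouville_inChart x₀) fun y hy => Ω.liouville_inChart_ne_zero hW hy

theorem Dens.contMDiff_ratio [MeasurableSpace M] {Ω : SymplecticForm n M} (ν : Ω.Dens) :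
    ContMDiff (𝓡 (2 * n)) 𝓘(ℝ, ℝ) ∞ (Ω.ratio ν.form) :=
  Ω.contMDiff_ratio ν.liouville_coeff_ne_zero ν.2.1

section Curves

variable [MeasurableSpace M] {Ω} {γ : ℝ → Ω.Dens}

theorem IsSmoothCurve.contDiffOn_ratio (hγ : IsSmoothCurve γ) (x₀ : M) :
    ContDiffOn ℝ ∞ (fun p : ℝ × Eucl (2 * n) =>
      Ω.ratio (γ p.1).form ((extChartAt (𝓡 (2 * n)) x₀).symm p.2))
      (univ ×ˢ (extChartAt (𝓡 (2 * n)) x₀).target) := by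
  have h1 : ContDiffOn ℝ ∞ (fun p : ℝ × Eucl (2 * n) =>
      (γ p.1).form.inChart x₀ p.2 (stdFrame (2 * n)) /
        Ω.liouvilleForm.inChart x₀ p.2 (stdFrame (2 * n)))
      (univ ×ˢ (extChartAt (𝓡 (2 * n)) x₀).target) :=
    ((contDiff_eval_alternating _).comp_contDiffOn (hγ x₀)).div
      ((Ω.contDiffOn_liouville_inChart x₀).comp contDiff_snd.contDiffOn fun p hp => hp.2)
      fun p hp => Ω.liouville_inChart_ne_zero (γ 0).liouville_coeff_ne_zero hp.2
  exact h1.congr fun p hp => Ω.ratio_symm _ hp.2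

theorem IsSmoothCurve.continuous_ratio (hγ : IsSmoothCurve γ) :
    Continuous fun p : ℝ × M => Ω.ratio (γ p.1).form p.2 := by
  refine continuous_iff_continuousAt.2 fun ⟨t, x⟩ => ?_
  have hT := isOpen_extChartAt_target (I := 𝓡 (2 * n)) x
  have h1 := ((hγ.contDiffOn_ratio x).continuousOn.continuousAt
    ((isOpen_univ.prod hT).mem_nhds (mk_mem_prod (mem_univ t) (mem_extChartAt_target x))))
  have h2 : ContinuousAt (fun p : ℝ × M => (p.1, extChartAt (𝓡 (2 * n)) x p.2)) (t, x) :=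
    continuousAt_fst.prodMk (ContinuousAt.comp (f := Prod.snd) (x := (t, x))
      (continuousAt_extChartAt (I := 𝓡 (2 * n)) x) continuousAt_snd)
  refine (ContinuousAt.comp (f := fun p : ℝ × M => (p.1, extChartAt (𝓡 (2 * n)) x p.2))
    (x := (t, x)) h1 h2).congr ?_
  filter_upwards [continuousAt_snd.preimage_mem_nhds
    (extChartAt_source_mem_nhds (I := 𝓡 (2 * n)) x)] with p hp
  simp only [Function.comp_apply]
  rw [(extChartAt (𝓡 (2 * n)) x).left_inv hp]

theorem IsSmoothCurve.hasDerivAt_ratio_chart (hγ : IsSmoothCurve γ) {x₀ : M} {y : Eucl (2 * n)}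
    (hy : y ∈ (extChartAt (𝓡 (2 * n)) x₀).target) (t : ℝ) :
    HasDerivAt (fun s => Ω.ratio (γ s).form ((extChartAt (𝓡 (2 * n)) x₀).symm y))
      (fderiv ℝ (fun p : ℝ × Eucl (2 * n) =>
        Ω.ratio (γ p.1).form ((extChartAt (𝓡 (2 * n)) x₀).symm p.2)) (t, y) (1, 0)) t := by
  have hT := isOpen_extChartAt_target (I := 𝓡 (2 * n)) x₀
  have h1 := (((hγ.contDiffOn_ratio x₀).contDiffAt ((isOpen_univ.prod hT).mem_nhds
    (mk_mem_prod (mem_univ t) hy))).differentiableAt (by simp)).hasFDerivAt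
  exact h1.comp_hasDerivAt (f := fun s : ℝ => (s, y)) t
    ((hasDerivAt_id t).prodMk (hasDerivAt_const t y))

/-- The time derivative of the function `ν_t / ωⁿ` along a curve. -/
def ratioDeriv (γ : ℝ → Ω.Dens) (t : ℝ) (x : M) : ℝ := deriv (fun s => Ω.ratio (γ s).form x) t

theorem IsSmoothCurve.hasDerivAt_ratio (hγ : IsSmoothCurve γ) (t : ℝ) (x : M) :
    HasDerivAt (fun s => Ω.ratio (γ s).form x) (ratioDeriv γ t x) t := by
  have h := hγ.hasDerivAt_ratio_chart (mem_extChartAt_target (I := 𝓡 (2 * n)) x) t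
  rw [extChartAt_to_inv x] at h
  exact h.differentiableAt.hasDerivAt

theorem IsSmoothCurve.continuous_ratioDeriv (hγ : IsSmoothCurve γ) :
    Continuous fun p : ℝ × M => ratioDeriv γ p.1 p.2 := by
  refine continuous_iff_continuousAt.2 fun ⟨t, x⟩ => ?_
  have hT := isOpen_extChartAt_target (I := 𝓡 (2 * n)) x
  have h1 := ((((hγ.contDiffOn_ratio x).continuousOn_fderiv_of_isOpen
    (isOpen_univ.prod hT) (by simp)).clm_apply
      (continuousOn_const (c := ((1 : ℝ), (0 : Eucl (2 * n)))))).continuousAt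
    ((isOpen_univ.prod hT).mem_nhds (mk_mem_prod (mem_univ t) (mem_extChartAt_target x))))
  have h2 : ContinuousAt (fun p : ℝ × M => (p.1, extChartAt (𝓡 (2 * n)) x p.2)) (t, x) :=
    continuousAt_fst.prodMk (ContinuousAt.comp (f := Prod.snd) (x := (t, x))
      (continuousAt_extChartAt (I := 𝓡 (2 * n)) x) continuousAt_snd)
  refine (ContinuousAt.comp (f := fun p : ℝ × M => (p.1, extChartAt (𝓡 (2 * n)) x p.2))
    (x := (t, x)) h1 h2).congr ?_
  filter_upwards [continuousAt_snd.preimage_mem_nhds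
    (extChartAt_source_mem_nhds (I := 𝓡 (2 * n)) x)] with p hp
  have h3 := (hγ.hasDerivAt_ratio_chart ((extChartAt (𝓡 (2 * n)) x).map_source hp) p.1).deriv
  rw [(extChartAt (𝓡 (2 * n)) x).left_inv hp] at h3
  exact h3.symm

variable [BorelSpace M] [CompactSpace M]

theorem IsSmoothCurve.hasDerivAt_linFunctional (hγ : IsSmoothCurve γ) {g : M → ℝ}
    (hg : Continuous g) (t : ℝ) :
    HasDerivAt (fun s => Ω.linFunctional g (γ s))
      (∫ x, g x * ratioDeriv γ t x ∂Ω.liouvilleMeasure) t := by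
  simp only [linFunctional_eq_integral]
  exact hasDerivAt_integral_of_continuous _ (F := fun s x => g x * Ω.ratio (γ s).form x)
    (F' := fun s x => g x * ratioDeriv γ s x)
    ((hg.comp continuous_snd).mul hγ.continuous_ratio)
    ((hg.comp continuous_snd).mul hγ.continuous_ratioDeriv)
    (fun s x => (hγ.hasDerivAt_ratio s x).const_mul _) t

theorem IsSmoothCurve.hasDerivAt_casimir (hγ : IsSmoothCurve γ) {φ : ℝ → ℝ}
    (hφ : ContDiff ℝ ∞ φ) (t : ℝ) :
    HasDerivAt (fun s => Ω.casimir φ (γ s))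
      (∫ x, deriv φ (Ω.ratio (γ t).form x) * ratioDeriv γ t x ∂Ω.liouvilleMeasure) t := by
  simp only [casimir_eq_integral]
  exact hasDerivAt_integral_of_continuous _ (F := fun s x => φ (Ω.ratio (γ s).form x))
    (F' := fun s x => deriv φ (Ω.ratio (γ s).form x) * ratioDeriv γ s x)
    (hφ.continuous.comp hγ.continuous_ratio)
    (((hφ.continuous_deriv (by simp)).comp hγ.continuous_ratio).mul hγ.continuous_ratioDeriv)
    (fun s x => ((hφ.differentiable (by simp) _).hasDerivAt).comp s (hγ.hasDerivAt_ratio s x)) t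

variable [T2Space M]

/-- The functionals `C_φ` with smooth `φ` are conserved along Hamiltonian trajectories: along the
trajectory, `dC_φ/dt = ∫ {φ'(ρ), f} ρ ωⁿ = ∫ {ρ φ'(ρ) - φ(ρ), f} ωⁿ = 0`. -/
theorem HamiltonianJoined.casimir_eq {ν ν' : Ω.Dens} (h : HamiltonianJoined ν ν') {φ : ℝ → ℝ}
    (hφ : ContDiff ℝ ∞ φ) : Ω.casimir φ ν = Ω.casimir φ ν' := by
  obtain ⟨f, γ, hf, hγ, htraj, rfl, rfl⟩ := h
  have hφ' : ContDiff ℝ ∞ (deriv φ) := hφ.iterate_deriv 1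
  have hΨ : ContDiff ℝ ∞ fun s => s * deriv φ s - φ s := (contDiff_id.mul hφ').sub hφ
  have hzero : ∀ t, HasDerivAt (fun s => Ω.casimir φ (γ s)) 0 t := by
    intro t
    set ρ := Ω.ratio (γ t).form with hρ
    have hρs : ContMDiff (𝓡 (2 * n)) 𝓘(ℝ, ℝ) ∞ ρ := (γ t).contMDiff_ratio
    have hft : ContMDiff (𝓡 (2 * n)) 𝓘(ℝ, ℝ) ∞ (f t) :=
      hf.comp (contMDiff_const.prodMk contMDiff_id)
    have hgs : ContMDiff (𝓡 (2 * n)) 𝓘(ℝ, ℝ) ∞ (deriv φ ∘ ρ) := hφ'.contMDiff.comp hρs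
    have h1 := (hγ.hasDerivAt_linFunctional hgs.continuous t).unique (htraj t _ hgs)
    have h2 : Ω.densBracket (deriv φ ∘ ρ) (f t) (γ t) = 0 := by
      rw [densBracket, linFunctional_eq_integral,
        ← Ω.integral_poissonBracket_eq_zero (γ t).liouville_coeff_ne_zero
          (hΨ.contMDiff.comp hρs : ContMDiff _ _ ∞ ((fun s => s * deriv φ s - φ s) ∘ ρ)) hft]
      refine integral_congr_ae (Filter.Eventually.of_forall fun x => ?_)
      have hd : deriv (fun s => s * deriv φ s - φ s) (ρ x) = ρ x * deriv (deriv φ) (ρ x) := by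
        have := ((hasDerivAt_id (ρ x)).mul (hφ'.differentiable (by simp) (ρ x)).hasDerivAt).sub
          (hφ.differentiable (by simp) (ρ x)).hasDerivAt
        refine this.deriv.trans ?_
        simp
      simp only
      rw [Ω.poissonBracket_comp_left hφ' hρs hft, Ω.poissonBracket_comp_left hΨ hρs hft, hd]
      ring
    have h3 := hγ.hasDerivAt_casimir hφ t
    rw [← h2, ← h1]
    exact h3
  exact is_const_of_deriv_eq_zero (fun t => (hzero t).differentiableAt)
    (fun t => (hzero t).deriv) 0 1

end Curves
end SymplecticForm

/-! ### Laws of continuous functions, and the Casimirs `C_h` -/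

section Perfect

variable {X : Type*} [TopologicalSpace X] [MeasurableSpace X]
  {μ : Measure X} [IsFiniteMeasure μ] [μ.InnerRegularCompactLTTop] {ρ : X → ℝ}

/-- The set `B` is the union of the images of compact sets that exhaust the preimage of `S` up to
measure zero. -/
theorem exists_measurable_subset_measure_preimage_le (hρ : Continuous ρ) {S : Set ℝ}
    (hS : NullMeasurableSet (ρ ⁻¹' S) μ) :
    ∃ B ⊆ S, MeasurableSet B ∧ μ (ρ ⁻¹' S) ≤ μ (ρ ⁻¹' B) := by
  obtain ⟨A, hAS, hA, hAe⟩ := hS.exists_measurable_subset_ae_eq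
  have hK : ∀ k : ℕ, ∃ K ⊆ A, IsCompact K ∧ μ A < μ K + ((k : ENNReal) + 1)⁻¹ := fun k =>
    hA.exists_isCompact_lt_add (measure_ne_top μ A) (by simp)
  choose K hKA hKc hKlt using hK
  refine ⟨⋃ k, ρ '' K k, ?_, ?_, ?_⟩
  · refine iUnion_subset fun k => ?_
    rintro _ ⟨x, hx, rfl⟩
    exact hAS (hKA k hx)
  · exact MeasurableSet.iUnion fun k => ((hKc k).image hρ).isClosed.measurableSet
  · rw [← measure_congr hAe]
    refine ENNReal.le_of_forall_pos_le_add fun ε hε _ => ?_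
    obtain ⟨k, hk⟩ := ENNReal.exists_inv_nat_lt (a := (ε : ENNReal)) (by simpa using hε.ne')
    refine (hKlt k).le.trans (add_le_add (measure_mono fun x hx => ?_) ?_)
    · exact mem_iUnion.2 ⟨k, x, hx, rfl⟩
    · exact (ENNReal.inv_le_inv.2 (by simp)).trans hk.le

variable [OpensMeasurableSpace X]

/-- Perfectness of finite measures that are inner regular for compact sets: a set of reals whose
preimage under a continuous function is measurable is itself measurable for the image measure. -/
theorem nullMeasurableSet_map_of_preimage (hρ : Continuous ρ) {S : Set ℝ}
    (hS : NullMeasurableSet (ρ ⁻¹' S) μ) : NullMeasurableSet S (μ.map ρ) := by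
  obtain ⟨B, hBS, hB, hBle⟩ := exists_measurable_subset_measure_preimage_le hρ hS
  obtain ⟨C, hCS, hC, hCle⟩ := exists_measurable_subset_measure_preimage_le hρ (S := Sᶜ) hS.compl
  have hle : μ.map ρ S ≤ μ.map ρ B := by
    calc μ.map ρ S ≤ μ.map ρ Cᶜ := measure_mono (subset_compl_comm.1 hCS)
      _ = μ (ρ ⁻¹' C)ᶜ := Measure.map_apply hρ.measurable hC.compl
      _ = μ univ - μ (ρ ⁻¹' C) := measure_compl (hρ.measurable hC) (measure_ne_top _ _)
      _ ≤ μ univ - μ (ρ ⁻¹' S)ᶜ := tsub_le_tsub_left hCle _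
      _ = μ (ρ ⁻¹' S) := by
        rw [← measure_compl₀ hS.compl (measure_ne_top _ _), compl_compl]
      _ ≤ μ (ρ ⁻¹' B) := hBle
      _ = μ.map ρ B := (Measure.map_apply hρ.measurable hB).symm
  exact hB.nullMeasurableSet.congr
    (ae_eq_of_subset_of_measure_ge hBS hle hB.nullMeasurableSet (measure_ne_top _ _))

theorem aestronglyMeasurable_comp_iff_map (hρ : Continuous ρ) (h : ℝ → ℝ) :
    AEStronglyMeasurable (fun x => h (ρ x)) μ ↔ AEStronglyMeasurable h (μ.map ρ) := by
  refine ⟨fun hm => ?_, fun hm => hm.comp_measurable hρ.measurable⟩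
  refine (NullMeasurable.aemeasurable fun E hE => ?_).aestronglyMeasurable
  exact nullMeasurableSet_map_of_preimage hρ (hm.aemeasurable.nullMeasurable hE)

theorem integrable_comp_iff_map (hρ : Continuous ρ) (h : ℝ → ℝ) :
    Integrable (fun x => h (ρ x)) μ ↔ Integrable h (μ.map ρ) := by
  by_cases hm : AEStronglyMeasurable h (μ.map ρ)
  · exact (integrable_map_measure hm hρ.measurable.aemeasurable).symm
  · exact ⟨fun hi => absurd ((aestronglyMeasurable_comp_iff_map hρ h).1 hi.1) hm,
      fun hi => absurd hi.1 hm⟩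

theorem integral_comp_eq_integral_map (hρ : Continuous ρ) (h : ℝ → ℝ) :
    ∫ x, h (ρ x) ∂μ = ∫ s, h s ∂(μ.map ρ) := by
  -- if `h` is not measurable for the law then both integrals are 0 by convention
  by_cases hm : AEStronglyMeasurable h (μ.map ρ)
  · exact (integral_map hρ.measurable.aemeasurable hm).symm
  · rw [integral_undef fun hi => hm hi.1, integral_undef fun hi =>
      hm ((aestronglyMeasurable_comp_iff_map hρ h).1 hi.1)]

end Perfect

/-- Two real functions on a finite measure space have the same law if the integrals of all their
compositions with smooth functions agree. -/
theorem map_eq_map_of_forall_integral_comp_eq {X : Type*} [MeasurableSpace X]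
    {μ : Measure X} [IsFiniteMeasure μ] {ρ ρ' : X → ℝ} (hρ : Measurable ρ) (hρ' : Measurable ρ')
    (h : ∀ φ : ℝ → ℝ, ContDiff ℝ ∞ φ → ∫ x, φ (ρ x) ∂μ = ∫ x, φ (ρ' x) ∂μ) :
    μ.map ρ = μ.map ρ' := by
  have key : ∀ {r : X → ℝ} (_ : Measurable r) (t : ℝ), charFun (μ.map r) t =
      (∫ x, Real.cos (t * r x) ∂μ : ℝ) + (∫ x, Real.sin (t * r x) ∂μ : ℝ) * Complex.I := by
    intro r hr t
    have hc : Integrable (fun x => Real.cos (t * r x)) μ :=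
      Integrable.of_bound (Real.measurable_cos.comp (hr.const_mul t)).aestronglyMeasurable 1
        (Filter.Eventually.of_forall fun x => Real.abs_cos_le_one _)
    have hs : Integrable (fun x => Real.sin (t * r x)) μ :=
      Integrable.of_bound (Real.measurable_sin.comp (hr.const_mul t)).aestronglyMeasurable 1
        (Filter.Eventually.of_forall fun x => Real.abs_sin_le_one _)
    rw [charFun_apply_real, integral_map hr.aemeasurable (by fun_prop)]
    have h1 : ∀ x, Complex.exp (t * r x * Complex.I) =
        (Real.cos (t * r x) : ℂ) + (Real.sin (t * r x) : ℂ) * Complex.I := by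
      intro x
      rw [Complex.exp_mul_I, Complex.ofReal_cos, Complex.ofReal_sin, Complex.ofReal_mul]
    simp only [h1]
    rw [integral_add hc.ofReal (hs.ofReal.mul_const _), integral_mul_const,
      integral_complex_ofReal, integral_complex_ofReal]
  refine Measure.ext_of_charFun (funext fun t => ?_)
  rw [key hρ, key hρ', h (fun s => Real.cos (t * s)) (by fun_prop),
    h (fun s => Real.sin (t * s)) (by fun_prop)]

namespace SymplecticForm

variable {n : ℕ} {M : Type*} [TopologicalSpace M] [T2Space M] [CompactSpace M]
  [ChartedSpace (Eucl (2 * n)) M] [MeasurableSpace M] [BorelSpace M] (Ω : SymplecticForm n M)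

theorem innerRegular_liouvilleMeasure : Ω.liouvilleMeasure.InnerRegularCompactLTTop := by
  have : SecondCountableTopology M :=
    ChartedSpace.secondCountable_of_sigmaCompact (Eucl (2 * n)) M
  let := TopologicalSpace.metrizableSpaceMetric M
  infer_instance

variable {Ω}

/-- The distribution of the function `ν / ωⁿ` with respect to the Liouville measure. -/
def law (ν : Ω.Dens) : Measure ℝ := Ω.liouvilleMeasure.map (Ω.ratio ν.form)

variable [IsManifold (𝓡 (2 * n)) ∞ M]

/-- The functional `C_h` depends on the law only, also for nonmeasurable `h`. -/
theorem casimir_eq_integral_law (h : ℝ → ℝ) (ν : Ω.Dens) : Ω.casimir h ν = ∫ s, h s ∂law ν := by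
  have := Ω.innerRegular_liouvilleMeasure
  rw [casimir_eq_integral]
  exact integral_comp_eq_integral_map ν.contMDiff_ratio.continuous h

theorem formIntegrable_casimirForm_iff (h : ℝ → ℝ) (ν : Ω.Dens) :
    Ω.FormIntegrable (Ω.casimirForm h ν) ↔ Integrable h (law ν) := by
  have := Ω.innerRegular_liouvilleMeasure
  rw [FormIntegrable, Ω.ratio_casimirForm ν.liouville_coeff_ne_zero]
  exact integrable_comp_iff_map ν.contMDiff_ratio.continuous h

theorem law_eq_of_mem_symplecticLeaf {ν ν' : Ω.Dens} (h : ν' ∈ symplecticLeaf ν) :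
    law ν' = law ν := by
  have h' : Relation.EqvGen HamiltonianJoined ν ν' := h
  induction h' with
  | rel ν ν' hj =>
    refine map_eq_map_of_forall_integral_comp_eq ν'.contMDiff_ratio.continuous.measurable
      ν.contMDiff_ratio.continuous.measurable fun φ hφ => ?_
    have := hj.casimir_eq hφ
    rw [casimir_eq_integral, casimir_eq_integral] at this
    exact this.symm
  | refl ν => rfl
  | symm ν ν' _ ih => exact (ih ‹_›).symm
  | trans ν ν' ν'' _ _ ih1 ih2 => exact (ih2 ‹_›).trans (ih1 ‹_›)

theorem isCasimir_casimir (h : ℝ → ℝ) : IsCasimir (Ω.casimir h) := fun ν ν' hν => by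
  rw [casimir_eq_integral_law, casimir_eq_integral_law, law_eq_of_mem_symplecticLeaf hν]

end SymplecticForm

/-! ### The topology of `Dens` -/

theorem DiffForm.IsSmooth.smul_fun {d k : ℕ} {M : Type*} [TopologicalSpace M]
    [ChartedSpace (Eucl d) M] [IsManifold (𝓡 d) ∞ M] {α : DiffForm d M k} (hα : α.IsSmooth)
    {f : M → ℝ} (hf : ContMDiff (𝓡 d) 𝓘(ℝ, ℝ) ∞ f) :
    DiffForm.IsSmooth (d := d) (M := M) (k := k) fun x => f x • α x := fun x₀ =>
  (hf.contDiffOn_comp_symm x₀).smul (hα x₀)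

namespace SymplecticForm

variable {n : ℕ} {M : Type*} [TopologicalSpace M]
  [ChartedSpace (Eucl (2 * n)) M] [MeasurableSpace M]
  {Ω : SymplecticForm n M}

theorem continuous_inChart_apply (x₀ : M) {y : Eucl (2 * n)}
    (hy : y ∈ (extChartAt (𝓡 (2 * n)) x₀).target) (v : Fin (2 * n) → Eucl (2 * n)) :
    Continuous fun ν : Ω.Dens => ν.form.inChart x₀ y v := by
  have h1 : Continuous fun ν : Ω.Dens => UniformOnFun.ofFun
      {K : Set (Eucl (2 * n)) | IsCompact K ∧ K ⊆ (extChartAt (𝓡 (2 * n)) x₀).target}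
      (iteratedFDeriv ℝ 0 (ν.form.inChart x₀)) :=
    continuous_iInf_dom (i := x₀) (continuous_iInf_dom (i := 0) continuous_induced_dom)
  have h2 := (UniformOnFun.uniformContinuous_eval_of_mem
    (β := ContinuousMultilinearMap ℝ (fun _ : Fin 0 => Eucl (2 * n))
      ((Eucl (2 * n)) [⋀^Fin (2 * n)]→L[ℝ] ℝ))
    {K : Set (Eucl (2 * n)) | IsCompact K ∧ K ⊆ (extChartAt (𝓡 (2 * n)) x₀).target}
    (mem_singleton y) ⟨isCompact_singleton, singleton_subset_iff.2 hy⟩).continuous.comp h1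
  have h3 : Continuous fun T : ContinuousMultilinearMap ℝ (fun _ : Fin 0 => Eucl (2 * n))
      ((Eucl (2 * n)) [⋀^Fin (2 * n)]→L[ℝ] ℝ) => T 0 v :=
    (contDiff_eval_alternating v).continuous.comp
      (ContinuousMultilinearMap.apply ℝ (fun _ : Fin 0 => Eucl (2 * n)) _ 0).continuous
  exact h3.comp h2

/-- Densities `a_k ν + b_k β` converge to `ν` in the `C^∞` topology if `a_k → 1` and `b_k → 0`. -/
theorem tendsto_dens_of_form_eq {α : ℕ → Ω.Dens} {ν : Ω.Dens} {β : DiffForm (2 * n) M (2 * n)}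
    (hβ : β.IsSmooth) {a b : ℕ → ℝ} (ha : Filter.Tendsto a Filter.atTop (𝓝 1))
    (hb : Filter.Tendsto b Filter.atTop (𝓝 0)) (h : ∀ k, (α k).form = a k • ν.form + b k • β) :
    Filter.Tendsto α Filter.atTop (𝓝 ν) := by
  rw [nhds_iInf, Filter.tendsto_iInf]
  intro x₀
  rw [nhds_iInf, Filter.tendsto_iInf]
  intro j
  rw [nhds_induced, Filter.tendsto_comap_iff, UniformOnFun.tendsto_iff_tendstoUniformlyOn]
  rintro K ⟨hK, hKT⟩
  have hT := isOpen_extChartAt_target (I := 𝓡 (2 * n)) x₀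
  have hν : ν.form.IsSmooth := ν.2.1
  have hcd {η : DiffForm (2 * n) M (2 * n)} (hη : η.IsSmooth) {y} (hy : y ∈ K) :
      ContDiffAt ℝ j (η.inChart x₀) y :=
    ((hη x₀).contDiffAt (hT.mem_nhds (hKT hy))).of_le (mod_cast le_top)
  have hbd {η : DiffForm (2 * n) M (2 * n)} (hη : η.IsSmooth) :
      ∃ C, ∀ y ∈ K, ‖iteratedFDeriv ℝ j (η.inChart x₀) y‖ ≤ C := by
    have hc : ContinuousOn (iteratedFDeriv ℝ j (η.inChart x₀)) K :=
      (((hη x₀).continuousOn_iteratedFDerivWithin (m := j) (mod_cast le_top) hT.uniqueDiffOn).congr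
        fun y hy => (iteratedFDerivWithin_of_isOpen j hT hy).symm).mono hKT
    exact hK.exists_bound_of_continuousOn hc
  obtain ⟨C, hC⟩ := hbd hν
  obtain ⟨D, hD⟩ := hbd hβ
  rw [Metric.tendstoUniformlyOn_iff]
  intro ε hε
  have hlim : Filter.Tendsto (fun k => |a k - 1| * |C| + |b k| * |D|) Filter.atTop (𝓝 0) := by
    have h1 := ((ha.sub_const 1).abs.mul_const |C|).add (hb.abs.mul_const |D|)
    simpa using h1
  filter_upwards [hlim.eventually_lt_const hε] with k hk y hy
  have hexp : iteratedFDeriv ℝ j ((α k).form.inChart x₀) y =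
      a k • iteratedFDeriv ℝ j (ν.form.inChart x₀) y +
        b k • iteratedFDeriv ℝ j (β.inChart x₀) y := by
    have h1 : ContDiffAt ℝ j (a k • ν.form.inChart x₀) y :=
      (hcd (η := ν.form) hν hy).const_smul (a k)
    have h2 : ContDiffAt ℝ j (b k • β.inChart x₀) y := (hcd hβ hy).const_smul (b k)
    rw [h k, DiffForm.inChart_add, DiffForm.inChart_smul, DiffForm.inChart_smul,
      iteratedFDeriv_add_apply h1 h2,
      iteratedFDeriv_const_smul_apply (hcd hν hy), iteratedFDeriv_const_smul_apply (hcd hβ hy)]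
  refine lt_of_le_of_lt ?_ hk
  rw [dist_comm, dist_eq_norm]
  change ‖iteratedFDeriv ℝ j ((α k).form.inChart x₀) y -
    iteratedFDeriv ℝ j (ν.form.inChart x₀) y‖ ≤ _
  rw [hexp]
  have e : a k • iteratedFDeriv ℝ j (ν.form.inChart x₀) y +
      b k • iteratedFDeriv ℝ j (β.inChart x₀) y - iteratedFDeriv ℝ j (ν.form.inChart x₀) y =
      (a k - 1) • iteratedFDeriv ℝ j (ν.form.inChart x₀) y +
        b k • iteratedFDeriv ℝ j (β.inChart x₀) y := by
    rw [sub_smul, one_smul]; abel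
  rw [e]
  refine (norm_add_le _ _).trans (add_le_add ?_ ?_)
  · rw [norm_smul, Real.norm_eq_abs]
    exact mul_le_mul_of_nonneg_left ((hC y hy).trans (le_abs_self C)) (abs_nonneg _)
  · rw [norm_smul, Real.norm_eq_abs]
    exact mul_le_mul_of_nonneg_left ((hD y hy).trans (le_abs_self D)) (abs_nonneg _)

variable [IsManifold (𝓡 (2 * n)) ∞ M]

theorem continuous_ratio_apply (x : M) : Continuous fun ν : Ω.Dens => Ω.ratio ν.form x := by
  have h := (continuous_inChart_apply (Ω := Ω) x (mem_extChartAt_target (I := 𝓡 (2 * n)) x)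
    (stdFrame (2 * n))).div_const (Ω.liouvilleForm.inChart x (extChartAt (𝓡 (2 * n)) x x)
      (stdFrame (2 * n)))
  refine h.congr fun ν => ?_
  rw [← Ω.ratio_symm ν.form (mem_extChartAt_target x), extChartAt_to_inv]

variable [BorelSpace M]

theorem isOpenPosMeasure_liouvilleMeasure (hW : ∀ x, Ω.liouvilleForm.coeff x ≠ 0) :
    Ω.liouvilleMeasure.IsOpenPosMeasure := by
  refine ⟨fun O hO ⟨x, hx⟩ h0 => ?_⟩
  have hle : Ω.chartMeasure x O = 0 := by
    rw [← liouvilleMeasure_restrict_source]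
    exact le_antisymm ((Measure.restrict_apply_le _ _).trans h0.le) bot_le
  rw [chartMeasure_apply _ _ hO.measurableSet] at hle
  have hA : IsOpen ((extChartAt (𝓡 (2 * n)) x).target ∩ (extChartAt (𝓡 (2 * n)) x).symm ⁻¹' O) :=
    (continuousOn_extChartAt_symm x).isOpen_inter_preimage (isOpen_extChartAt_target x) hO
  rw [lintegral_eq_zero_iff' ((Ω.aemeasurable_chartDensity x).mono_measure
    (Measure.restrict_mono inter_subset_left le_rfl))] at hle
  have hae := (ae_restrict_iff' hA.measurableSet).1 hle
  refine hA.measure_ne_zero volume ⟨extChartAt (𝓡 (2 * n)) x x, mem_extChartAt_target x, ?_⟩ ?_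
  · rwa [mem_preimage, extChartAt_to_inv]
  · refine measure_mono_null (fun y hy => ?_) (ae_iff.1 hae)
    refine fun hcon => ?_
    have h1 := hcon hy
    simp only [chartDensity, Pi.zero_apply, ENNReal.ofReal_eq_zero] at h1
    exact absurd (abs_nonpos_iff.1 h1) (Ω.liouville_inChart_ne_zero hW hy.1)

end SymplecticForm

/-! ### Differentials of the functionals `C_φ` -/

namespace SymplecticForm

variable {n : ℕ} {M : Type*} [TopologicalSpace M] [CompactSpace M]
  [ChartedSpace (Eucl (2 * n)) M] [IsManifold (𝓡 (2 * n)) ∞ M] [MeasurableSpace M] [BorelSpace M]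
  {Ω : SymplecticForm n M}

omit [CompactSpace M] [IsManifold (𝓡 (2 * n)) ∞ M] [BorelSpace M] in
theorem Dens.integral_ratio (ν : Ω.Dens) : ∫ x, Ω.ratio ν.form x ∂Ω.liouvilleMeasure = 1 := ν.2.2.2

/-- The linear form `β ↦ ∫ φ'(ν / ωⁿ) β`, the differential of `C_φ` at `ν`. -/
def casimirDifferential (φ : ℝ → ℝ) (hφ : ContDiff ℝ ∞ φ) (ν : Ω.Dens) :
    Module.Dual ℝ Ω.tangentDens :=
  have hi (β : Ω.tangentDens) : Integrable (fun x => deriv φ (Ω.ratio ν.form x) * Ω.ratio β x)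
      Ω.liouvilleMeasure :=
    (((hφ.continuous_deriv (by simp)).comp ν.contMDiff_ratio.continuous).mul
      (Ω.contMDiff_ratio ν.liouville_coeff_ne_zero β.2.1).continuous).integrable_liouville Ω
  { toFun := fun β => ∫ x, deriv φ (Ω.ratio ν.form x) * Ω.ratio β x ∂Ω.liouvilleMeasure
    map_add' := fun β β' => by
      rw [← integral_add (hi β) (hi β')]
      simp only [Submodule.coe_add, Ω.ratio_add, Pi.add_apply, mul_add]
    map_smul' := fun c β => by
      rw [RingHom.id_apply, smul_eq_mul, ← integral_const_mul]
      simp only [Submodule.coe_smul, Ω.ratio_smul, Pi.smul_apply, smul_eq_mul, mul_left_comm] }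

theorem casimirDifferential_apply (φ : ℝ → ℝ) (hφ : ContDiff ℝ ∞ φ) (ν : Ω.Dens)
    (β : Ω.tangentDens) : casimirDifferential φ hφ ν β =
      ∫ x, deriv φ (Ω.ratio ν.form x) * Ω.ratio β x ∂Ω.liouvilleMeasure := rfl

theorem hasDifferentialAt_casimir (φ : ℝ → ℝ) (hφ : ContDiff ℝ ∞ φ) (ν : Ω.Dens) :
    HasDifferentialAt (Ω.casimir φ) (casimirDifferential φ hφ ν) ν := by
  rintro γ β hγ rfl hβ
  rw [casimirDifferential_apply]
  have h : ∀ x, ratioDeriv γ 0 x = Ω.ratio β x := fun x => (hβ.hasDerivAt_ratio x).deriv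
  simpa only [h] using hγ.hasDerivAt_casimir hφ 0

/-- The differentials of the functionals `C_{s^(k+2)}` are linearly independent at every density
whose quotient by `ωⁿ` takes infinitely many values. -/
theorem linearIndependent_casimirDifferential {ν : Ω.Dens}
    (hν : (range (Ω.ratio ν.form)).Infinite) :
    LinearIndependent ℝ fun k : ℕ =>
      casimirDifferential (fun s => s ^ (k + 2)) (contDiff_id.pow (k + 2)) ν := by
  rw [linearIndependent_iff']
  intro s c hc
  set ρ := Ω.ratio ν.form with hρ
  have hρs : ContMDiff (𝓡 (2 * n)) 𝓘(ℝ, ℝ) ∞ ρ := ν.contMDiff_ratio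
  let P : Polynomial ℝ := ∑ k ∈ s, Polynomial.C (c k * (k + 2)) * Polynomial.X ^ (k + 1)
  have hP (r : ℝ) : P.eval r = ∑ k ∈ s, c k * ((k + 2) * r ^ (k + 1)) := by
    simp only [P, Polynomial.eval_finsetSum, Polynomial.eval_mul, Polynomial.eval_C,
      Polynomial.eval_pow, Polynomial.eval_X, mul_assoc]
  have hPs : ContMDiff (𝓡 (2 * n)) 𝓘(ℝ, ℝ) ∞ fun x => P.eval (ρ x) := by
    have hPc : ContDiff ℝ ∞ fun r => P.eval r := by simp only [hP]; fun_prop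
    exact hPc.contMDiff.comp hρs
  set m := ∫ x, P.eval (ρ x) * ρ x ∂Ω.liouvilleMeasure with hm
  have hint {g : M → ℝ} (hg : Continuous g) : Integrable g Ω.liouvilleMeasure :=
    hg.integrable_liouville Ω
  -- the tangent vector `(P(ρ) - m) ν`, where `m` is the mean value of `P(ρ)` for `ν`
  have hβs : ContMDiff (𝓡 (2 * n)) 𝓘(ℝ, ℝ) ∞ fun x => P.eval (ρ x) - m := hPs.sub contMDiff_const
  have hβr (x : M) : Ω.ratio (fun x => (P.eval (ρ x) - m) • ν.form x) x =
      (P.eval (ρ x) - m) * ρ x := Ω.ratio_smul_fun _ _ x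
  have hβ0 : ∫ x, (P.eval (ρ x) - m) * ρ x ∂Ω.liouvilleMeasure = 0 := by
    have i1 : Integrable (fun x => P.eval (ρ x) * ρ x) Ω.liouvilleMeasure :=
      hint (hPs.continuous.mul hρs.continuous)
    have i2 : Integrable (fun x => m * ρ x) Ω.liouvilleMeasure :=
      hint (continuous_const.mul hρs.continuous)
    simp only [sub_mul]
    rw [integral_sub i1 i2, integral_const_mul, hρ, ν.integral_ratio, ← hρ,
      mul_one, ← hm, sub_self]
  let β : Ω.tangentDens := ⟨fun x => (P.eval (ρ x) - m) • ν.form x,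
    DiffForm.IsSmooth.smul_fun ν.2.1 hβs, by
      refine (hint (hβs.continuous.mul hρs.continuous)).congr ?_
      exact Filter.Eventually.of_forall fun x => (hβr x).symm, by
      rw [integral, ← hβ0]
      exact integral_congr_ae (Filter.Eventually.of_forall hβr)⟩
  have h1 : ∫ x, P.eval (ρ x) * ((P.eval (ρ x) - m) * ρ x) ∂Ω.liouvilleMeasure = 0 := by
    have h2 := LinearMap.congr_fun hc β
    rw [LinearMap.sum_apply] at h2
    simp only [LinearMap.smul_apply, casimirDifferential_apply, smul_eq_mul,
      LinearMap.zero_apply, ← integral_const_mul] at h2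
    rw [← integral_finsetSum] at h2
    · rw [← h2]
      refine integral_congr_ae (Filter.Eventually.of_forall fun x => ?_)
      dsimp only
      rw [hP, Finset.sum_mul]
      refine Finset.sum_congr rfl fun k _ => ?_
      have hd : deriv (fun s : ℝ => s ^ (k + 2)) (ρ x) = (k + 2) * ρ x ^ (k + 1) := by
        simp
      have hb : Ω.ratio β x = (P.eval (ρ x) - m) * ρ x := hβr x
      rw [← hρ, hd, hb, ← hP]
      ring
    · intro k _
      have hcd : ContDiff ℝ ∞ fun s : ℝ => s ^ (k + 2) := contDiff_id.pow (k + 2)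
      exact hint (continuous_const.mul (((hcd.continuous_deriv (by simp)).comp hρs.continuous).mul
        (Ω.contMDiff_ratio ν.liouville_coeff_ne_zero β.2.1).continuous))
  have h3 : ∫ x, (P.eval (ρ x) - m) ^ 2 * ρ x ∂Ω.liouvilleMeasure = 0 := by
    have e : ∀ x, (P.eval (ρ x) - m) ^ 2 * ρ x =
        P.eval (ρ x) * ((P.eval (ρ x) - m) * ρ x) - m * ((P.eval (ρ x) - m) * ρ x) := fun x => by
      ring
    have i1 : Integrable (fun x => P.eval (ρ x) * ((P.eval (ρ x) - m) * ρ x)) Ω.liouvilleMeasure :=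
      hint (hPs.continuous.mul (hβs.continuous.mul hρs.continuous))
    have i2 : Integrable (fun x => m * ((P.eval (ρ x) - m) * ρ x)) Ω.liouvilleMeasure :=
      hint (continuous_const.mul (hβs.continuous.mul hρs.continuous))
    simp only [e]
    rw [integral_sub i1 i2, integral_const_mul, h1, hβ0,
      mul_zero, sub_zero]
  have hpos (x : M) : 0 < ρ x := ν.2.2.1 x
  have hcq : Continuous fun x => (P.eval (ρ x) - m) ^ 2 * ρ x :=
    (hβs.continuous.pow 2).mul hρs.continuous
  have := isOpenPosMeasure_liouvilleMeasure ν.liouville_coeff_ne_zero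
  have h4 := (integral_eq_zero_iff_of_nonneg
    (fun x => mul_nonneg (sq_nonneg _) (hpos x).le) (hint hcq)).1 h3
  have h5 := (Continuous.ae_eq_iff_eq Ω.liouvilleMeasure hcq continuous_zero).1 h4
  -- `P - m` vanishes at the infinitely many values of `ρ`
  have h6 : P = Polynomial.C m := by
    refine Polynomial.eq_of_infinite_eval_eq _ _ (hν.mono ?_)
    rintro _ ⟨x, rfl⟩
    have h7 : (P.eval (ρ x) - m) ^ 2 * ρ x = 0 := congrFun h5 x
    have h8 := (mul_eq_zero.1 h7).resolve_right (hpos x).ne'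
    rw [mem_ofPred_eq, Polynomial.eval_C]
    exact sub_eq_zero.1 (pow_eq_zero_iff two_ne_zero |>.1 h8)
  intro k hk
  have h9 := congrArg (fun Q => Q.coeff (k + 1)) h6
  simp only [P, Polynomial.finsetSum_coeff, Polynomial.coeff_C_mul, Polynomial.coeff_X_pow,
    Polynomial.coeff_C_succ] at h9
  simp [hk] at h9
  exact h9.resolve_right (by positivity)

end SymplecticForm

/-! ### Densities with nonconstant quotient -/

namespace SymplecticForm

variable {n : ℕ} {M : Type*} [TopologicalSpace M] [ChartedSpace (Eucl (2 * n)) M]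
  [IsManifold (𝓡 (2 * n)) ∞ M] [MeasurableSpace M] {Ω : SymplecticForm n M}

/-- The densities whose quotient by `ωⁿ` is not constant on the set `B`. -/
def nonconstantOn (Ω : SymplecticForm n M) (B : Set M) : Set Ω.Dens :=
  {ν | ∃ p ∈ B, ∃ q ∈ B, Ω.ratio ν.form p ≠ Ω.ratio ν.form q}

theorem isOpen_nonconstantOn (B : Set M) : IsOpen (nonconstantOn Ω B) := by
  have h : nonconstantOn Ω B =
      ⋃ p ∈ B, ⋃ q ∈ B, {ν : Ω.Dens | Ω.ratio ν.form p ≠ Ω.ratio ν.form q} := by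
    ext ν; simp [nonconstantOn]
  rw [h]
  exact isOpen_biUnion fun p _ => isOpen_biUnion fun q _ =>
    isOpen_ne_fun (continuous_ratio_apply p) (continuous_ratio_apply q)

theorem infinite_range_ratio {B : Set M} (hB : IsPreconnected B) {ν : Ω.Dens}
    (hν : ν ∈ nonconstantOn Ω B) : (range (Ω.ratio ν.form)).Infinite := by
  obtain ⟨p, hp, q, hq, hpq⟩ := hν
  have himg := hB.image _ ν.contMDiff_ratio.continuous.continuousOn
  have hnt : (Ω.ratio ν.form '' B).Nontrivial :=
    ⟨_, mem_image_of_mem _ hp, _, mem_image_of_mem _ hq, hpq⟩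
  exact (himg.infinite_of_nontrivial hnt).mono (image_subset_range _ _)

variable [BorelSpace M] [CompactSpace M]

/-- For a smooth function `ψ ≥ 0`, the multiple of `(1 + s ψ) ν` that has total integral 1. -/
theorem exists_dens_one_add_smul (ν : Ω.Dens) {ψ : M → ℝ}
    (hψ : ContMDiff (𝓡 (2 * n)) 𝓘(ℝ, ℝ) ∞ ψ) (hψ0 : ∀ x, 0 ≤ ψ x) {s : ℝ} (hs : 0 ≤ s) :
    ∃ ν' : Ω.Dens, ν'.form =
      (1 + s * ∫ x, ψ x * Ω.ratio ν.form x ∂Ω.liouvilleMeasure)⁻¹ • ν.form +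
      ((1 + s * ∫ x, ψ x * Ω.ratio ν.form x ∂Ω.liouvilleMeasure)⁻¹ * s) •
        (fun x => ψ x • ν.form x : DiffForm (2 * n) M (2 * n)) := by
  set I := ∫ x, ψ x * Ω.ratio ν.form x ∂Ω.liouvilleMeasure with hI
  have hpos (x : M) : 0 < Ω.ratio ν.form x := ν.2.2.1 x
  have hI0 : 0 ≤ I := integral_nonneg fun x => mul_nonneg (hψ0 x) (hpos x).le
  have hc : 0 < (1 + s * I)⁻¹ := by positivity
  set c := (1 + s * I)⁻¹ with hcdef
  have hψν : DiffForm.IsSmooth (d := 2 * n) (M := M) (k := 2 * n) fun x => ψ x • ν.form x :=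
    DiffForm.IsSmooth.smul_fun ν.2.1 hψ
  have hr (x : M) : Ω.ratio (c • ν.form + (c * s) •
      (fun x => ψ x • ν.form x : DiffForm (2 * n) M (2 * n))) x =
      c * Ω.ratio ν.form x + c * s * (ψ x * Ω.ratio ν.form x) := by
    rw [Ω.ratio_add, Ω.ratio_smul, Ω.ratio_smul, Pi.add_apply, Pi.smul_apply, Pi.smul_apply,
      Ω.ratio_smul_fun, smul_eq_mul, smul_eq_mul]
  refine ⟨⟨_, (DiffForm.IsSmooth.smul c ν.2.1).add (hψν.smul (c * s)), fun x => ?_, ?_⟩, rfl⟩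
  · refine (hr x).symm ▸ add_pos_of_pos_of_nonneg (mul_pos hc (hpos x)) ?_
    exact mul_nonneg (mul_nonneg hc.le hs) (mul_nonneg (hψ0 x) (hpos x).le)
  · have hcont : Continuous (Ω.ratio ν.form) := ν.contMDiff_ratio.continuous
    have i1 : Integrable (fun x => c * Ω.ratio ν.form x) Ω.liouvilleMeasure :=
      (continuous_const.mul hcont).integrable_liouville Ω
    have i2 : Integrable (fun x => c * s * (ψ x * Ω.ratio ν.form x)) Ω.liouvilleMeasure :=
      (continuous_const.mul (hψ.continuous.mul hcont)).integrable_liouville Ω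
    refine (integral_congr_ae (Filter.Eventually.of_forall hr)).trans ?_
    rw [integral_add i1 i2, integral_const_mul, integral_const_mul, ν.integral_ratio, ← hI, hcdef]
    field_simp

/-- If `ν / ωⁿ` is constant on `B`, then `(1 + s ψ) ν` with a smooth function `ψ` that separates two
points of `B` has nonconstant quotient for every `s > 0`. -/
theorem dense_nonconstantOn [T2Space M] {B : Set M} {p q : M} (hp : p ∈ B) (hq : q ∈ B)
    (hpq : p ≠ q) : Dense (nonconstantOn Ω B) := by
  intro ν
  by_cases hν : ν ∈ nonconstantOn Ω B
  · exact subset_closure hν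
  have hconst : Ω.ratio ν.form p = Ω.ratio ν.form q := by
    by_contra h
    exact hν ⟨p, hp, q, hq, h⟩
  obtain ⟨ψ, hψq, hψp, hψ01⟩ := exists_contMDiffMap_zero_one_of_isClosed (n := ⊤) (𝓡 (2 * n))
    (isClosed_singleton (x := q)) (isClosed_singleton (x := p)) (by simpa using hpq.symm)
  have hψ1 : ψ p = 1 := hψp rfl
  have hψ0 : ψ q = 0 := hψq rfl
  set I := ∫ x, ψ x * Ω.ratio ν.form x ∂Ω.liouvilleMeasure with hI
  have hI0 : 0 ≤ I := integral_nonneg fun x => mul_nonneg (hψ01 x).1 (ν.2.2.1 x).le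
  choose α hα using fun k : ℕ => exists_dens_one_add_smul ν ψ.contMDiff (fun x => (hψ01 x).1)
    (s := 1 / ((k : ℝ) + 1)) (by positivity)
  have hs : Filter.Tendsto (fun k : ℕ => 1 / ((k : ℝ) + 1)) Filter.atTop (𝓝 0) :=
    tendsto_one_div_add_atTop_nhds_zero_nat
  have ha : Filter.Tendsto (fun k : ℕ => (1 + 1 / ((k : ℝ) + 1) * I)⁻¹) Filter.atTop (𝓝 1) := by
    have := ((hs.mul_const I).const_add 1).inv₀ (by simp)
    simpa using this
  have hb : Filter.Tendsto (fun k : ℕ => (1 + 1 / ((k : ℝ) + 1) * I)⁻¹ * (1 / ((k : ℝ) + 1)))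
      Filter.atTop (𝓝 0) := by
    simpa using ha.mul hs
  refine mem_closure_of_tendsto (tendsto_dens_of_form_eq
    (DiffForm.IsSmooth.smul_fun ν.2.1 ψ.contMDiff) ha hb hα)
    (Filter.Eventually.of_forall fun k => ⟨p, hp, q, hq, ?_⟩)
  rw [hα k, Ω.ratio_add, Ω.ratio_smul, Ω.ratio_smul]
  simp only [Pi.add_apply, Pi.smul_apply, Ω.ratio_smul_fun, smul_eq_mul, hψ0, hψ1, hconst]
  have hpos : 0 < Ω.ratio ν.form q := ν.2.2.1 q
  have hk : 0 < (1 + 1 / ((k : ℝ) + 1) * I)⁻¹ * (1 / ((k : ℝ) + 1)) * Ω.ratio ν.form q := by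
    positivity
  intro h
  simp only [← hI] at h
  linarith

variable [T2Space M]

theorem functionallyIndependent_casimir (hn : 1 ≤ n) :
    FunctionallyIndependent fun k : ℕ => Ω.casimir fun s => s ^ (k + 2) := by
  rcases isEmpty_or_nonempty M with hM | ⟨⟨x₀⟩⟩
  · -- on the empty manifold there is no density of total integral 1
    refine ⟨univ, isOpen_univ, dense_univ, fun ν _ => ?_⟩
    have h := ν.integral_ratio
    rw [integral_of_isEmpty] at h
    exact absurd h zero_ne_one
  set φ := extChartAt (𝓡 (2 * n)) x₀ with hφ
  obtain ⟨r, hr, hball⟩ := Metric.isOpen_iff.1 (isOpen_extChartAt_target (I := 𝓡 (2 * n)) x₀)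
    (φ x₀) (mem_extChartAt_target x₀)
  -- a second point of the ball; it exists because the dimension is positive
  let y : Eucl (2 * n) := φ x₀ + (r / 2) • stdFrame (2 * n) ⟨0, by omega⟩
  have hy : y ∈ Metric.ball (φ x₀) r := by
    simp only [y, Metric.mem_ball, dist_self_add_left, norm_smul, Real.norm_eq_abs,
      PiLp.norm_single]
    rw [abs_of_pos (by positivity)]
    simpa using hr
  have hyne : y ≠ φ x₀ := by
    simp only [y, ne_eq, add_eq_left, smul_eq_zero]
    rintro (h | h)
    · linarith
    · simp at h
  have hx : φ x₀ ∈ Metric.ball (φ x₀) r := Metric.mem_ball_self hr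
  have hB : IsPreconnected (φ.symm '' Metric.ball (φ x₀) r) :=
    (convex_ball _ _).isPreconnected.image _ ((continuousOn_extChartAt_symm x₀).mono hball)
  refine ⟨nonconstantOn Ω (φ.symm '' Metric.ball (φ x₀) r), isOpen_nonconstantOn _,
    dense_nonconstantOn (mem_image_of_mem _ hx) (mem_image_of_mem _ hy)
      fun h => hyne (φ.symm.injOn (hball hx) (hball hy) h).symm, fun ν hν => ?_⟩
  exact ⟨fun k => casimirDifferential (fun s => s ^ (k + 2)) (contDiff_id.pow (k + 2)) ν,
    fun k => hasDifferentialAt_casimir _ _ ν,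
    linearIndependent_casimirDifferential (infinite_range_ratio hB hν)⟩

end SymplecticForm

end

open SymplecticForm in
theorem mainTheorem1 (n : ℕ) (hn : 1 ≤ n) (M : Type*) [TopologicalSpace M] [T2Space M]
    [CompactSpace M] [ChartedSpace (Eucl (2 * n)) M] [IsManifold (𝓡 (2 * n)) ∞ M]
    [MeasurableSpace M] [BorelSpace M] (Ω : SymplecticForm n M) :
    (∀ h : ℝ → ℝ, IsCasimir (Ω.casimir h) ∧
      ∀ ν : Ω.Dens, ∀ ν' ∈ symplecticLeaf ν,
        (Ω.FormIntegrable (Ω.casimirForm h ν') ↔ Ω.FormIntegrable (Ω.casimirForm h ν))) ∧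
    ∃ h : ℕ → ℝ → ℝ, (∀ k, ContDiff ℝ ∞ (h k)) ∧ (∀ k, IsCasimir (Ω.casimir (h k))) ∧
      FunctionallyIndependent (fun k => Ω.casimir (h k)) := by
  refine ⟨fun h => ⟨isCasimir_casimir h, fun ν ν' hν => ?_⟩,
    fun k s => s ^ (k + 2), fun k => contDiff_id.pow (k + 2), fun k => isCasimir_casimir _,
    functionallyIndependent_casimir hn⟩
  rw [formIntegrable_casimirForm_iff, formIntegrable_casimirForm_iff,
    law_eq_of_mem_symplecticLeaf hν]
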